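/- Let $n\ge 1$. A convex body in $\mathbb R^n$ is a compact convex set with non-empty interior; it is centered if its barycentre $\frac1{|K|}\int_K x\,dx$ is $0$. Here $|\cdot|$ is Lebesgue measure in the corresponding subspace (with $|\{0\}|=1$ in dimension $0$). A convex body $K$ is isotropic, with isotropic constant $L_K\ge 0$, if $|K|=1$, $K$ is centered and $\int_K\langle x,\theta\rangle^2dx=L_K^2$ for every unit vector $\theta$; the isotropic constant $L_K$ of an arbitrary convex body $K$ is that of any of its isotropic affine images $a+TK$ ($a\in\mathbb R^n$, $T\in GL(n)$). Put $L_n=\max L_K$, the maximum over all convex bodies $K\subseteq\mathbb R^n$. For a centered convex body $K\subseteq\mathbb R^n$ let $$\tilde\Lambda(K)=\min\frac{|K|^{n-1}}{\prod_{i=1}^n|K\cap w_i^\perp|},$$ the minimum over all orthonormal bases $(w_i)_{i=1}^n$ of $\mathbb R^n$, and let $\tilde\Lambda(n)=\sup\tilde\Lambda(K)$, the supremum over all centered convex bodies $K\subseteq\mathbb R^n$. Let $Z_2(K)$ be the inertia ellipsoid of $K$, with support function $h_{Z_2(K)}(y)=\left(\frac1{|K|}\int_K\langle x,y\rangle^2dx\right)^{1/2}$.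 **Theorem 1.1.** The minimum defining $\tilde\Lambda(K)$ and the maximum defining $L_n$ are attained. For every centered convex body $K\subseteq\mathbb R^n$, $$\tilde\Lambda(K)\le\left(2\sqrt3\,L_K\right)^n.$$ More precisely, $Z_2(K)$ is an ellipsoid, and every orthonormal basis $(w_i)$ consisting of principal axes of $Z_2(K)$ satisfies $$\frac{|K|^{n-1}}{\prod_{i=1}^n|K\cap w_i^\perp|}\le\left(2\sqrt3\,L_K\right)^n.$$ Furthermore, $$\left(\sqrt2\,L_n\right)^n\le\tilde\Lambda(n)\le\left(2\sqrt3\,L_n\right)^n.$$ -/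

import Mathlib

open MeasureTheory
open scoped ENNReal

noncomputable section

namespace ReverseLW

/-- `ℝⁿ` with its Euclidean structure. -/
abbrev E (n : ℕ) : Type := EuclideanSpace ℝ (Fin n)

/-- A convex body: a compact convex set with non-empty interior. -/
structure IsConvexBody {n : ℕ} (K : Set (E n)) : Prop where
  isCompact : IsCompact K
  convex : Convex ℝ K
  interior_nonempty : (interior K).Nonempty

/-- The barycentre `|K|⁻¹ ∫_K x dx`. -/
def barycentre {n : ℕ} (K : Set (E n)) : E n :=
  (volume.real K)⁻¹ • ∫ x in K, x

/-- `K` is centered if its barycentre is the origin. -/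
def IsCentered {n : ℕ} (K : Set (E n)) : Prop :=
  barycentre K = 0

/-- `K` is an isotropic convex body and `L ≥ 0` is the constant with
`∫_K ⟨x, θ⟩² dx = L²` for every unit vector `θ`. -/
structure IsIsotropicWith {n : ℕ} (K : Set (E n)) (L : ℝ) : Prop where
  isConvexBody : IsConvexBody K
  volume_eq_one : volume K = 1
  isCentered : IsCentered K
  nonneg : 0 ≤ L
  second_moment : ∀ θ : E n, ‖θ‖ = 1 → ∫ x in K, (inner ℝ x θ) ^ 2 = L ^ 2

/-- The isotropic constant `L_K`: the isotropic constant of any isotropic affine image `a + T K`,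
`a ∈ ℝⁿ`, `T ∈ GL(n)`. (For a convex body in dimension `n ≥ 1` the set below has exactly one
element; `sInf` picks that element.) -/
def isotropicConstant {n : ℕ} (K : Set (E n)) : ℝ :=
  sInf {L : ℝ | ∃ (a : E n) (T : E n ≃ₗ[ℝ] E n),
    IsIsotropicWith ((fun x => a + T x) '' K) L}

/-- The isotropic constants of all convex bodies in `ℝⁿ`. -/
def isotropicConstants (n : ℕ) : Set ℝ :=
  {L : ℝ | ∃ K : Set (E n), IsConvexBody K ∧ isotropicConstant K = L}

/-- The maximal isotropic constant `L_n`. -/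
def maxIsotropicConstant (n : ℕ) : ℝ :=
  sSup (isotropicConstants n)

/-- `|K ∩ w^⊥|`: the volume of the central section of `K` orthogonal to `w`, with respect to
Lebesgue measure on the subspace `w^⊥` (the unit mass at the origin if `w^⊥ = {0}`). -/
def sectionVolume {n : ℕ} (K : Set (E n)) (w : E n) : ℝ≥0∞ :=
  volume {x : (Submodule.span ℝ {w})ᗮ | (x : E n) ∈ K}

/-- `|K|^{n-1} / ∏ |K ∩ w_i^⊥|` for an orthonormal basis `w`. -/
def dualLWRatio {n : ℕ} (K : Set (E n)) (w : OrthonormalBasis (Fin n) ℝ (E n)) : ℝ≥0∞ :=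
  volume K ^ (n - 1) / ∏ i, sectionVolume K (w i)

/-- `Λ̃(K)`: the least value of the ratio over all orthonormal bases. -/
def dualLambda {n : ℕ} (K : Set (E n)) : ℝ≥0∞ :=
  ⨅ w : OrthonormalBasis (Fin n) ℝ (E n), dualLWRatio K w

/-- `Λ̃(n)`: the supremum of `Λ̃(K)` over all centered convex bodies in `ℝⁿ`. -/
def dualLambdaSup (n : ℕ) : ℝ≥0∞ :=
  ⨆ (K : Set (E n)) (_ : IsConvexBody K) (_ : IsCentered K), dualLambda K

/-- `h_{Z₂(K)}(y) = (|K|⁻¹ ∫_K ⟨x, y⟩² dx)^{1/2}`; the factor `|K|⁻¹` is `1` if `|K| = 1`, and in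
general it only rescales the body. -/
def inertiaSupport {n : ℕ} (K : Set (E n)) (y : E n) : ℝ :=
  Real.sqrt ((volume.real K)⁻¹ * ∫ x in K, (inner ℝ x y) ^ 2)

/-- The inertia ellipsoid `Z₂(K)`: the closed convex set with support function
`inertiaSupport K`. -/
def inertiaEllipsoid {n : ℕ} (K : Set (E n)) : Set (E n) :=
  {x : E n | ∀ y : E n, inner ℝ x y ≤ inertiaSupport K y}

/-- `w` is a system of principal axes of `Z`: for some semi-axes `r i > 0`, `Z` is the ellipsoid
`{x | ∑ (⟨x, w_i⟩ / r_i)² ≤ 1}`. -/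
def IsPrincipalAxes {n : ℕ} (w : OrthonormalBasis (Fin n) ℝ (E n)) (Z : Set (E n)) : Prop :=
  ∃ r : Fin n → ℝ, (∀ i, 0 < r i) ∧ Z = {x : E n | ∑ i, (inner ℝ x (w i) / r i) ^ 2 ≤ 1}

end ReverseLW

end

noncomputable section

namespace ReverseLW

open Set Filter Topology
open scoped Pointwise

/-! ### The Brunn–Minkowski inequality in multiplicative form -/

/-! For a unit vector `w`, let `f(t)` be the volume of the section of a centered body `K` by `⟨x, w⟩
= t`. By Brunn–Minkowski `f` is log-concave, by Fubini its mass is `|K|` and its second moment is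
`∫_K ⟨x, w⟩²`, and centering says `∫ t f = 0`. Everything rests on the two-sided estimate `(∫ f)³ /
12 ≤ f(0)² ∫ t² f ≤ (∫ f)³ / 2` for such `f` (`le_sq_mul_second_moment`, `sq_mul_second_moment_le`).
The constants are those of the uniform density on a centered interval and of the limiting case
`exp(-|t|)`. So a central section is, up to constants, `|K|` divided by the standard deviation in
the normal direction (`sectionProfile_bounds`).

The covariance operator turns this into a statement about `L_K`. It transforms as `T Cov T*` under
affine maps and equals `L² id` for an isotropic body, whence `(L_K ^ n |K|)² = det Cov(K)`. Along
principal axes of `Z₂(K)` the covariance is diagonal with entries `rᵢ²`, so `∏ rᵢ = L_K ^ n |K|`,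
and multiplying the lower estimates over the axes gives the factor `(2√3 L_K) ^ n`. For an isotropic
body the standard deviation is `L_K` in every direction, so multiplying the upper estimates gives
`(√2 L_K) ^ n` as a lower bound for every orthonormal basis. Applied to an isotropic image of a body
with `L_K = L_n`, this bounds `Λ̃(n)` from below.

Both extrema come from compactness. Mapping a simplex of maximal volume in `K` to the standard one
places an affine image of `K` between that simplex and the cube. Such bodies form a
Hausdorff-compact family on which `det Cov / |K|² = L_K ^ (2n)` is continuous. For the minimum over
bases, the product of section volumes is upper semicontinuous on the compact set of orthonormal
frames. -/

/-- `C` contains the translate of `A` by `min B` and that of `B` by `max A`. The first lies to the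
left of `max A + min B` and the second to the right, so they overlap in at most one point. -/
theorem volume_add_volume_le_of_isCompact {A B C : Set ℝ} (hA : IsCompact A) (hB : IsCompact B)
    (hAn : A.Nonempty) (hBn : B.Nonempty) (h : ∀ x ∈ A, ∀ y ∈ B, x + y ∈ C) :
    volume A + volume B ≤ volume C := by
  have ha := hA.sSup_mem hAn
  have hb := hB.sInf_mem hBn
  set a := sSup A
  set b := sInf B
  have h1 : volume ((fun x => b + x) '' A) = volume A := by
    rw [image_add_left, measure_preimage_add]
  have h2 : volume ((fun x => a + x) '' B) = volume B := by
    rw [image_add_left, measure_preimage_add]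
  have hA' : IsCompact ((fun x => b + x) '' A) := hA.image (by fun_prop)
  have hB' : IsCompact ((fun x => a + x) '' B) := hB.image (by fun_prop)
  have hdisj : AEDisjoint volume ((fun x => b + x) '' A) ((fun x => a + x) '' B) := by
    refine measure_mono_null (t := {a + b}) ?_ (by simp)
    rintro z ⟨⟨x, hx, rfl⟩, ⟨y, hy, hxy⟩⟩
    have hxa : x ≤ a := le_csSup hA.bddAbove hx
    have hyb : b ≤ y := csInf_le hB.bddBelow hy
    simp only [mem_singleton_iff] at hxy ⊢
    linarith
  rw [← h1, ← h2, ← measure_union₀ hB'.measurableSet.nullMeasurableSet hdisj]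
  refine measure_mono ?_
  rintro z (⟨x, hx, rfl⟩ | ⟨y, hy, rfl⟩)
  · simpa [add_comm] using h x hx b hb
  · exact h a ha y hy

theorem volume_add_volume_le {A B C : Set ℝ} (hA : MeasurableSet A) (hB : MeasurableSet B)
    (hAn : A.Nonempty) (hBn : B.Nonempty) (h : ∀ x ∈ A, ∀ y ∈ B, x + y ∈ C) :
    volume A + volume B ≤ volume C := by
  have key : ∀ A' ⊆ A, ∀ B' ⊆ B, IsCompact A' → IsCompact B' →
      volume A' + volume B' ≤ volume C := by
    intro A' hA' B' hB' hcA hcB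
    obtain ⟨a, ha⟩ := hAn
    obtain ⟨b, hb⟩ := hBn
    -- The compact subsets may be empty, so a point of `A` and one of `B` are added.
    calc volume A' + volume B' ≤ volume (insert a A') + volume (insert b B') := by
          gcongr <;> exact subset_insert _ _
      _ ≤ volume C := volume_add_volume_le_of_isCompact (hcA.insert a) (hcB.insert b)
          (insert_nonempty _ _) (insert_nonempty _ _) fun x hx y hy =>
            h x (insert_subset ha hA' hx) y (insert_subset hb hB' hy)
  rw [hA.measure_eq_iSup_isCompact, hB.measure_eq_iSup_isCompact]
  simp only [iSup_and']
  exact ENNReal.biSup_add_biSup_le' (p := fun A' => A' ⊆ A ∧ IsCompact A')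
    (q := fun B' => B' ⊆ B ∧ IsCompact B') ⟨∅, empty_subset _, isCompact_empty⟩
    ⟨∅, empty_subset _, isCompact_empty⟩ fun A' hA' B' hB' => key A' hA'.1 B' hB'.1 hA'.2 hB'.2

theorem volume_combo_le {A B C : Set ℝ} (hA : MeasurableSet A) (hB : MeasurableSet B)
    (hAn : A.Nonempty) (hBn : B.Nonempty) {s t : ℝ} (hs : 0 < s) (ht : 0 < t)
    (h : ∀ x ∈ A, ∀ y ∈ B, s * x + t * y ∈ C) :
    ENNReal.ofReal s * volume A + ENNReal.ofReal t * volume B ≤ volume C := by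
  have e : ∀ (r : ℝ), 0 < r → ∀ S : Set ℝ, volume (r • S) = ENNReal.ofReal r * volume S := by
    intro r hr S
    simp [Measure.addHaar_smul, abs_of_pos hr]
  rw [← e s hs, ← e t ht]
  refine volume_add_volume_le (hA.const_smul₀ s) (hB.const_smul₀ t) hAn.smul_set hBn.smul_set ?_
  rintro _ ⟨x, hx, rfl⟩ _ ⟨y, hy, rfl⟩
  exact h x hx y hy

/-- The additive form of the one-dimensional Prékopa–Leindler inequality, for functions with
equal suprema. -/
theorem lintegral_combo_le {f g h : ℝ → ℝ} (hf : Measurable f) (hg : Measurable g)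
    (hh : Measurable h) (hf0 : ∀ x, 0 ≤ f x) (hg0 : ∀ x, 0 ≤ g x) (hh0 : ∀ x, 0 ≤ h x)
    {s t : ℝ} (hs : 0 < s) (ht : 0 < t) (hst : s + t = 1)
    (hfg : ∀ x y, f x ^ s * g y ^ t ≤ h (s * x + t * y)) (hf1 : IsLUB (range f) 1)
    (hg1 : IsLUB (range g) 1) :
    ENNReal.ofReal s * (∫⁻ x, ENNReal.ofReal (f x)) +
        ENNReal.ofReal t * (∫⁻ x, ENNReal.ofReal (g x))
      ≤ ∫⁻ x, ENNReal.ofReal (h x) := by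
  rw [lintegral_eq_lintegral_meas_lt _ (ae_of_all _ hf0) hf.aemeasurable,
    lintegral_eq_lintegral_meas_lt _ (ae_of_all _ hg0) hg.aemeasurable,
    lintegral_eq_lintegral_meas_lt _ (ae_of_all _ hh0) hh.aemeasurable]
  have mf : ∀ u : ℝ → ℝ, Measurable fun t : ℝ => volume {a | t < u a} := fun u =>
    Antitone.measurable fun a b hab => measure_mono fun x (hx : b < u x) => lt_of_le_of_lt hab hx
  rw [← lintegral_const_mul _ (mf f), ← lintegral_const_mul _ (mf g),
    ← lintegral_add_left ((mf f).const_mul _)]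
  refine setLIntegral_mono (mf h) fun r hr => ?_
  -- Layer cake: below the common supremum both superlevel sets are nonempty and one-dimensional
  -- Brunn–Minkowski applies to them; above it both are empty. This is where equal suprema are
  -- needed.
  rcases lt_or_ge r 1 with hr1 | hr1
  · obtain ⟨_, ⟨x, rfl⟩, hx, -⟩ := hf1.exists_between hr1
    obtain ⟨_, ⟨y, rfl⟩, hy, -⟩ := hg1.exists_between hr1
    refine volume_combo_le (measurableSet_lt measurable_const hf)
      (measurableSet_lt measurable_const hg) ⟨x, hx⟩ ⟨y, hy⟩ hs ht ?_
    intro x hx y hy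
    simp only [mem_ofPred_eq] at hx hy ⊢
    refine lt_of_lt_of_le ?_ (hfg x y)
    calc r = r ^ s * r ^ t := by rw [← Real.rpow_add hr, hst, Real.rpow_one]
      _ < f x ^ s * g y ^ t := mul_lt_mul'' (Real.rpow_lt_rpow hr.le hx hs)
          (Real.rpow_lt_rpow hr.le hy ht) (by have : (0:ℝ) < r := hr; positivity)
          (by have : (0:ℝ) < r := hr; positivity)
  · have h1 : {a | r < f a} = ∅ := by
      ext x; simpa using (hf1.1 ⟨x, rfl⟩).trans hr1
    have h2 : {a | r < g a} = ∅ := by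
      ext x; simpa using (hg1.1 ⟨x, rfl⟩).trans hr1
    simp [h1, h2]

/-- The one-dimensional Prékopa–Leindler inequality for bounded functions. -/
theorem prekopa_leindler_one {f g h : ℝ → ℝ} (hf : Measurable f) (hg : Measurable g)
    (hh : Measurable h) (hf0 : ∀ x, 0 ≤ f x) (hg0 : ∀ x, 0 ≤ g x) (hh0 : ∀ x, 0 ≤ h x)
    (hfb : BddAbove (range f)) (hgb : BddAbove (range g))
    {s t : ℝ} (hs : 0 < s) (ht : 0 < t) (hst : s + t = 1)
    (hfg : ∀ x y, f x ^ s * g y ^ t ≤ h (s * x + t * y))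
    (hH : ∫⁻ x, ENNReal.ofReal (h x) ≠ ∞) :
    (∫⁻ x, ENNReal.ofReal (f x)).toReal ^ s * (∫⁻ x, ENNReal.ofReal (g x)).toReal ^ t ≤
      (∫⁻ x, ENNReal.ofReal (h x)).toReal := by
  have fz : ∀ u : ℝ → ℝ, (∀ x, 0 ≤ u x) → BddAbove (range u) → ¬ 0 < sSup (range u) →
      ∫⁻ x, ENNReal.ofReal (u x) = 0 := by
    intro u hu hb hn
    have : ∀ x, ENNReal.ofReal (u x) = 0 := fun x =>
      ENNReal.ofReal_eq_zero.2 ((le_csSup hb ⟨x, rfl⟩).trans (not_lt.1 hn))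
    simp [this]
  by_cases ha : 0 < sSup (range f)
  swap
  · rw [fz f hf0 hfb ha]; simp [Real.zero_rpow hs.ne']
  by_cases hb : 0 < sSup (range g)
  swap
  · rw [fz g hg0 hgb hb]; simp [Real.zero_rpow ht.ne']
  set a := sSup (range f) with ha'
  set b := sSup (range g) with hb'
  have lub : ∀ (u : ℝ → ℝ) (c : ℝ), 0 < c → IsLUB (range u) c →
      IsLUB (range fun x => c⁻¹ * u x) 1 := by
    intro u c hc hu
    have := hu.mul_left (a := c⁻¹) (by positivity)
    rw [inv_mul_cancel₀ hc.ne'] at this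
    rwa [← range_comp] at this
  have lin : ∀ (u : ℝ → ℝ) (c : ℝ), 0 < c → ∫⁻ x, ENNReal.ofReal (c⁻¹ * u x) =
      ENNReal.ofReal c⁻¹ * ∫⁻ x, ENNReal.ofReal (u x) := by
    intro u c hc
    simp_rw [ENNReal.ofReal_mul (inv_nonneg.2 hc.le)]
    rw [lintegral_const_mul' _ _ ENNReal.ofReal_ne_top]
  have hab : 0 < a ^ s * b ^ t := by positivity
  -- Dividing `f`, `g` by their suprema and `h` by `a ^ s * b ^ t` preserves the hypothesis. The
  -- resulting bound on the arithmetic mean is stronger than the desired one, by weighted AM–GM.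
  have key := lintegral_combo_le (hf.const_mul a⁻¹) (hg.const_mul b⁻¹)
    (hh.const_mul (a ^ s * b ^ t)⁻¹)
    (fun x => mul_nonneg (by positivity) (hf0 x)) (fun x => mul_nonneg (by positivity) (hg0 x))
    (fun x => mul_nonneg (by positivity) (hh0 x)) hs ht hst (fun x y => ?_)
    (lub f a ha (isLUB_csSup (range_nonempty _) hfb))
    (lub g b hb (isLUB_csSup (range_nonempty _) hgb))
  · rw [lin f a ha, lin g b hb, lin h _ hab] at key
    set F := ∫⁻ x, ENNReal.ofReal (f x)
    set G := ∫⁻ x, ENNReal.ofReal (g x)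
    set H := ∫⁻ x, ENNReal.ofReal (h x)
    have hfin : ENNReal.ofReal (a ^ s * b ^ t)⁻¹ * H ≠ ∞ :=
      ENNReal.mul_ne_top ENNReal.ofReal_ne_top hH
    have k2 := ENNReal.toReal_mono hfin key
    have t1 : ENNReal.ofReal s * (ENNReal.ofReal a⁻¹ * F) ≠ ∞ :=
      ne_top_of_le_ne_top hfin (le_self_add.trans key)
    have t2 : ENNReal.ofReal t * (ENNReal.ofReal b⁻¹ * G) ≠ ∞ :=
      ne_top_of_le_ne_top hfin (le_add_self.trans key)
    rw [ENNReal.toReal_add t1 t2] at k2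
    simp only [ENNReal.toReal_mul] at k2
    rw [ENNReal.toReal_ofReal hs.le, ENNReal.toReal_ofReal ht.le,
      ENNReal.toReal_ofReal (by positivity), ENNReal.toReal_ofReal (by positivity),
      ENNReal.toReal_ofReal (by positivity)] at k2
    have amgm := Real.geom_mean_le_arith_mean2_weighted hs.le ht.le
      (p₁ := a⁻¹ * F.toReal) (p₂ := b⁻¹ * G.toReal) (by positivity) (by positivity) hst
    have k3 := amgm.trans k2
    rw [Real.mul_rpow (by positivity) (by positivity), Real.mul_rpow (by positivity) (by positivity),
      Real.inv_rpow ha.le, Real.inv_rpow hb.le] at k3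
    calc F.toReal ^ s * G.toReal ^ t
        = (a ^ s * b ^ t) * (((a ^ s)⁻¹ * F.toReal ^ s) * ((b ^ t)⁻¹ * G.toReal ^ t)) := by
          field_simp
      _ ≤ (a ^ s * b ^ t) * ((a ^ s * b ^ t)⁻¹ * H.toReal) := by gcongr
      _ = H.toReal := by field_simp
  · rw [Real.mul_rpow (by positivity) (hf0 x), Real.mul_rpow (by positivity) (hg0 y),
      Real.inv_rpow ha.le, Real.inv_rpow hb.le, mul_inv]
    calc (a ^ s)⁻¹ * f x ^ s * ((b ^ t)⁻¹ * g y ^ t)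
        = (a ^ s)⁻¹ * (b ^ t)⁻¹ * (f x ^ s * g y ^ t) := by ring
      _ ≤ _ := by gcongr; exact hfg x y

/-- Induction on the dimension: the induction hypothesis says that the volumes of the slices at
fixed first coordinate satisfy the hypothesis of the one-dimensional Prékopa–Leindler inequality,
and integrating them recovers the volumes. -/
theorem brunn_minkowski_pi {n : ℕ} {A B C : Set (Fin n → ℝ)} (hA : IsCompact A) (hB : IsCompact B)
    (hC : IsCompact C) {s t : ℝ} (hs : 0 < s) (ht : 0 < t) (hst : s + t = 1)
    (h : ∀ x ∈ A, ∀ y ∈ B, s • x + t • y ∈ C) :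
    volume.real A ^ s * volume.real B ^ t ≤ volume.real C := by
  induction n with
  | zero =>
    rcases A.eq_empty_or_nonempty with rfl | ⟨x, hx⟩
    · simp [Real.zero_rpow hs.ne']
    rcases B.eq_empty_or_nonempty with rfl | ⟨y, hy⟩
    · simp [Real.zero_rpow ht.ne']
    have e : ∀ S : Set (Fin 0 → ℝ), ∀ z ∈ S, volume.real S = 1 := by
      intro S z hz
      have : S = univ := by
        ext w; simp [Subsingleton.elim w z, hz]
      rw [this, measureReal_def, volume_pi, Measure.pi_univ]
      simp
    rw [e A x hx, e B y hy, e C _ (h x hx y hy)]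
    simp
  | succ n ih =>
    set e := MeasurableEquiv.piFinSuccAbove (fun _ : Fin (n + 1) => ℝ) 0 with he
    have hme : MeasurePreserving e volume volume :=
      volume_preserving_piFinSuccAbove (fun _ => ℝ) 0
    have hcont : Continuous fun p : ℝ × (Fin n → ℝ) => (Fin.cons p.1 p.2 : Fin (n + 1) → ℝ) :=
      Continuous.finCons (A := fun _ => ℝ) continuous_fst continuous_snd
    let sec : Set (Fin (n + 1) → ℝ) → ℝ → Set (Fin n → ℝ) := fun S r =>
      {y | (Fin.cons r y : Fin (n + 1) → ℝ) ∈ S}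
    have hsc : ∀ S, IsCompact S → ∀ r, IsCompact (sec S r) := by
      intro S hS r
      have hcl : IsClosed (sec S r) :=
        hS.isClosed.preimage (hcont.comp (Continuous.prodMk continuous_const continuous_id))
      refine (hS.image (f := fun z i => z (Fin.succ i)) (by fun_prop)).of_isClosed_subset hcl ?_
      intro y hy
      exact ⟨_, hy, by ext i; simp⟩
    have hmS : ∀ S, IsCompact S → MeasurableSet (e.symm ⁻¹' S) := fun S hS =>
      e.symm.measurable hS.measurableSet
    have hsec : ∀ S r, Prod.mk r ⁻¹' (e.symm ⁻¹' S) = sec S r := by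
      intro S r
      ext y
      simp [e, sec, MeasurableEquiv.piFinSuccAbove, Fin.consEquiv]
    have hmeas : ∀ S, IsCompact S → Measurable fun r => volume.real (sec S r) := by
      intro S hS
      have := measurable_measure_prodMk_left (ν := (volume : Measure (Fin n → ℝ))) (hmS S hS)
      simp only [hsec] at this
      exact this.ennreal_toReal
    have hint : ∀ S, IsCompact S →
        volume S = ∫⁻ r, ENNReal.ofReal (volume.real (sec S r)) := by
      intro S hS
      rw [← (hme.symm e).measure_preimage_equiv S, Measure.volume_eq_prod,
        Measure.prod_apply (hmS S hS)]
      simp only [hsec]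
      refine lintegral_congr fun r => ?_
      rw [measureReal_def, ENNReal.ofReal_toReal (hsc S hS r).measure_lt_top.ne]
    have hbdd : ∀ S, IsCompact S → BddAbove (range fun r => volume.real (sec S r)) := by
      intro S hS
      have hcP := hS.image (f := fun (z : Fin (n + 1) → ℝ) i => z (Fin.succ i)) (by fun_prop)
      refine ⟨volume.real ((fun (z : Fin (n + 1) → ℝ) i => z (Fin.succ i)) '' S), ?_⟩
      rintro _ ⟨r, rfl⟩
      refine measureReal_mono ?_ hcP.measure_lt_top.ne
      intro y hy
      exact ⟨_, hy, by ext i; simp⟩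
    have := prekopa_leindler_one (hmeas A hA) (hmeas B hB) (hmeas C hC)
      (fun _ => measureReal_nonneg) (fun _ => measureReal_nonneg) (fun _ => measureReal_nonneg)
      (hbdd A hA) (hbdd B hB) hs ht hst (fun x y => ?_)
      (by rw [← hint C hC]; exact hC.measure_lt_top.ne)
    · rwa [← hint A hA, ← hint B hB, ← hint C hC] at this
    · refine ih (hsc A hA x) (hsc B hB y) (hsc C hC _) fun u hu v hv => ?_
      have := h _ hu _ hv
      simp only [sec, mem_ofPred_eq]
      convert this using 1
      ext i
      refine Fin.cases ?_ (fun i => ?_) i <;> simp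

/-- The Brunn–Minkowski inequality in multiplicative form. -/
theorem brunn_minkowski {V : Type*} [NormedAddCommGroup V] [InnerProductSpace ℝ V]
    [FiniteDimensional ℝ V] [MeasurableSpace V] [BorelSpace V] {A B C : Set V}
    (hA : IsCompact A) (hB : IsCompact B) (hC : IsCompact C) {s t : ℝ} (hs : 0 < s) (ht : 0 < t)
    (hst : s + t = 1) (h : ∀ x ∈ A, ∀ y ∈ B, s • x + t • y ∈ C) :
    volume.real A ^ s * volume.real B ^ t ≤ volume.real C := by
  let b := stdOrthonormalBasis ℝ V
  let e : V ≃ᵐ (Fin (Module.finrank ℝ V) → ℝ) :=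
    b.measurableEquiv.trans (MeasurableEquiv.toLp 2 _).symm
  have he : MeasurePreserving e volume volume :=
    (PiLp.volume_preserving_ofLp _).comp b.measurePreserving_measurableEquiv
  have hsymm : ∀ x, e.symm x = b.repr.symm (WithLp.toLp 2 x) := fun _ => rfl
  have hcont : Continuous e := by
    change Continuous fun x => WithLp.ofLp (b.repr x)
    fun_prop
  have hvol : ∀ S : Set V, volume.real (e '' S) = volume.real S := by
    intro S
    rw [measureReal_def, measureReal_def, e.image_eq_preimage_symm,
      (he.symm e).measure_preimage_equiv]
  rw [← hvol A, ← hvol B, ← hvol C]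
  refine brunn_minkowski_pi (hA.image hcont) (hB.image hcont) (hC.image hcont) hs ht hst ?_
  rintro _ ⟨x, hx, rfl⟩ _ ⟨y, hy, rfl⟩
  refine ⟨_, h x hx y hy, ?_⟩
  change WithLp.ofLp (b.repr _) = s • WithLp.ofLp (b.repr x) + t • WithLp.ofLp (b.repr y)
  simp

/-! ### Moments of log-concave functions on a half-line -/

theorem setLIntegral_Ioi_eq_shift (f : ℝ → ℝ≥0∞) (a b : ℝ) :
    ∫⁻ t in Ioi (a + b), f t = ∫⁻ u in Ioi b, f (a + u) := by
  have h := (measurePreserving_add_left (volume : Measure ℝ) a).setLIntegral_comp_preimage_emb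
    (measurableEmbedding_addLeft a) f (Ioi (a + b))
  rw [← h]
  congr 2
  ext x; simp

theorem setLIntegral_Ioc_eq_shift (f : ℝ → ℝ≥0∞) (a b c : ℝ) :
    ∫⁻ t in Ioc (a + b) (a + c), f t = ∫⁻ u in Ioc b c, f (a + u) := by
  have h := (measurePreserving_add_left (volume : Measure ℝ) a).setLIntegral_comp_preimage_emb
    (measurableEmbedding_addLeft a) f (Ioc (a + b) (a + c))
  rw [← h]
  congr 2
  ext x; simp

theorem lintegral_mul_tail {φ f : ℝ → ℝ≥0∞} (hφ : Measurable φ) (hf : Measurable f) :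
    ∫⁻ x in Ioi 0, φ x * ∫⁻ t in Ioi x, f t = ∫⁻ t in Ioi 0, f t * ∫⁻ x in Ioo 0 t, φ x := by
  have h1 : ∀ x ∈ Ioi (0:ℝ), φ x * ∫⁻ t in Ioi x, f t =
      ∫⁻ t in Ioi 0, φ x * ({q : ℝ × ℝ | q.1 < q.2}.indicator (fun q => f q.2) (x, t)) := by
    intro x hx
    rw [lintegral_const_mul]
    · congr 1
      rw [← lintegral_indicator measurableSet_Ioi, ← lintegral_indicator measurableSet_Ioi]
      refine lintegral_congr fun t => ?_
      have hx' : (0:ℝ) < x := hx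
      by_cases hxt : x < t
      · simp [indicator, hxt, hx'.trans hxt]
      · simp [indicator, hxt]
    · exact ((hf.comp measurable_snd).indicator
        (measurableSet_lt measurable_fst measurable_snd)).comp measurable_prodMk_left
  rw [setLIntegral_congr_fun measurableSet_Ioi h1, lintegral_lintegral_swap]
  · refine setLIntegral_congr_fun measurableSet_Ioi fun t ht => ?_
    rw [← lintegral_const_mul _ hφ, ← lintegral_indicator measurableSet_Ioi,
      ← lintegral_indicator measurableSet_Ioo]
    refine lintegral_congr fun x => ?_
    by_cases h0 : 0 < x <;> by_cases hxt : x < t <;> simp [indicator, h0, hxt, mul_comm]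
  · refine (Measurable.mul (hφ.comp measurable_fst) ?_).aemeasurable
    exact (hf.comp measurable_snd).indicator (measurableSet_lt measurable_fst measurable_snd)

theorem lintegral_tail {f : ℝ → ℝ≥0∞} (hf : Measurable f) :
    ∫⁻ x in Ioi (0:ℝ), ∫⁻ t in Ioi x, f t = ∫⁻ t in Ioi 0, ENNReal.ofReal t * f t := by
  have := lintegral_mul_tail (φ := fun _ => 1) measurable_const hf
  simp only [one_mul] at this
  rw [this]
  refine lintegral_congr fun t => ?_
  simp [mul_comm]

theorem lintegral_id_mul_tail {f : ℝ → ℝ≥0∞} (hf : Measurable f) :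
    ∫⁻ x in Ioi (0:ℝ), ENNReal.ofReal x * ∫⁻ t in Ioi x, f t =
      ∫⁻ t in Ioi 0, ENNReal.ofReal (t ^ 2 / 2) * f t := by
  rw [lintegral_mul_tail (by fun_prop) hf]
  refine setLIntegral_congr_fun measurableSet_Ioi fun t ht => ?_
  have ht' : (0:ℝ) ≤ t := le_of_lt ht
  have : ∫⁻ x in Ioo 0 t, ENNReal.ofReal x = ENNReal.ofReal (t ^ 2 / 2) := by
    rw [← ofReal_integral_eq_lintegral_ofReal]
    · rw [← integral_Ioc_eq_integral_Ioo, ← intervalIntegral.integral_of_le ht', integral_id]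
      simp
    · exact (continuous_id.integrableOn_Icc).mono_set Ioo_subset_Icc_self
    · exact (ae_restrict_mem measurableSet_Ioo).mono fun x hx => hx.1.le
  simp only [this, mul_comm]

/-- By Tonelli, `∫ t g(t) dt` is the double integral of `g(x + u)` over the quadrant, and `(∫ g)²`
that of `g(x) g(u)`; the hypothesis compares the integrands. It is used for a log-concave density
and again for its tail. -/
theorem mul_lintegral_id_mul_le_sq {g : ℝ → ℝ≥0∞} (hg : Measurable g)
    (h : ∀ s, 0 < s → ∀ t, 0 < t → g 0 * g (s + t) ≤ g s * g t) :
    g 0 * ∫⁻ t in Ioi 0, ENNReal.ofReal t * g t ≤ (∫⁻ t in Ioi 0, g t) ^ 2 := by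
  have hF : Measurable fun x => ∫⁻ t in Ioi x, g t :=
    Antitone.measurable fun a b hab => lintegral_mono_set (Ioi_subset_Ioi hab)
  rw [← lintegral_tail hg, ← lintegral_const_mul _ hF, sq, ← lintegral_mul_const _ hg]
  refine setLIntegral_mono' measurableSet_Ioi fun x hx => ?_
  have : ∫⁻ t in Ioi x, g t = ∫⁻ u in Ioi 0, g (x + u) := by
    simpa using setLIntegral_Ioi_eq_shift g x 0
  rw [this, ← lintegral_const_mul _ (by fun_prop), ← lintegral_const_mul _ hg]
  exact setLIntegral_mono' measurableSet_Ioi fun u hu => h x hx u hu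

/-- Tails inherit the submultiplicativity of a log-concave function, so that the previous estimate
can be iterated to reach second moments. -/
theorem tail_mul_tail_le {f : ℝ → ℝ≥0∞} (hf : Measurable f)
    (h : ∀ a b c d, a ≤ b → a ≤ c → a + d = b + c → f a * f d ≤ f b * f c) {s t : ℝ}
    (hs : 0 < s) (ht : 0 < t) :
    (∫⁻ u in Ioi 0, f u) * ∫⁻ u in Ioi (s + t), f u ≤
      (∫⁻ u in Ioi s, f u) * ∫⁻ u in Ioi t, f u := by
  have split : ∀ a b : ℝ, a ≤ b →
      ∫⁻ u in Ioi a, f u = (∫⁻ u in Ioc a b, f u) + ∫⁻ u in Ioi b, f u := by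
    intro a b hab
    rw [← lintegral_union measurableSet_Ioi, Ioc_union_Ioi_eq_Ioi hab]
    exact Set.disjoint_left.2 fun x hx hx' => not_lt.2 hx.2 hx'
  have h3 : ∫⁻ u in Ioi t, f u = (∫⁻ u in Ioc t (t + s), f u) + ∫⁻ u in Ioi (s + t), f u := by
    rw [add_comm s t]; exact split t (t + s) (by linarith)
  rw [split 0 s hs.le, h3, add_mul, mul_add]
  -- Splitting the first factor on the left at `s` and the last factor on the right at `s + t`
  -- produces the same product of tails on both sides. What remains is the pointwise inequality
  -- `f(v) f(s + t + u) ≤ f(t + v) f(s + u)` for `0 < v ≤ s`, `u > 0`.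
  refine add_le_add ?_ le_rfl
  have e1 : ∫⁻ u in Ioi (s + t), f u = ∫⁻ u in Ioi 0, f (s + t + u) := by
    simpa using setLIntegral_Ioi_eq_shift f (s + t) 0
  have e2 : ∫⁻ u in Ioi s, f u = ∫⁻ u in Ioi 0, f (s + u) := by
    simpa using setLIntegral_Ioi_eq_shift f s 0
  have e3 : ∫⁻ u in Ioc t (t + s), f u = ∫⁻ u in Ioc 0 s, f (t + u) := by
    simpa using setLIntegral_Ioc_eq_shift f t 0 s
  rw [e1, e2, e3, mul_comm (∫⁻ u in Ioi 0, f (s + u)), ← lintegral_mul_const _ hf,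
    ← lintegral_mul_const _ (by fun_prop)]
  refine setLIntegral_mono' measurableSet_Ioc fun v hv => ?_
  rw [← lintegral_const_mul _ (by fun_prop), ← lintegral_const_mul _ (by fun_prop)]
  refine setLIntegral_mono' measurableSet_Ioi fun u hu => ?_
  have hu' : (0:ℝ) < u := hu
  exact h _ _ _ _ (by linarith [hv.1]) (by linarith [hv.2]) (by ring)

/-- Bounded, compactly supported, log-concave functions on the line. -/
structure IsLogConcaveProfile (f : ℝ → ℝ) : Prop where
  nonneg : ∀ x, 0 ≤ f x
  measurable : Measurable f
  bounded : ∃ M, ∀ x, f x ≤ M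
  support : ∃ R, ∀ x, R < |x| → f x = 0
  logConcave : ∀ x y s t : ℝ, 0 < s → 0 < t → s + t = 1 → f x ^ s * f y ^ t ≤ f (s * x + t * y)

namespace IsLogConcaveProfile

variable {f : ℝ → ℝ}

/-- The inner points `b` and `c` are convex combinations of `a` and `d` with interchanged weights,
so the exponents add up to one when the two log-concavity inequalities are multiplied. -/
theorem four_point (hf : IsLogConcaveProfile f) {a b c d : ℝ} (hab : a ≤ b) (hac : a ≤ c)
    (h : a + d = b + c) : f a * f d ≤ f b * f c := by
  rcases hab.eq_or_lt with rfl | hab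
  · rw [show d = c by linarith]
  rcases hac.eq_or_lt with rfl | hac
  · rw [show d = b by linarith, mul_comm]
  rcases (hf.nonneg a).eq_or_lt with h0 | ha
  · rw [← h0, zero_mul]; exact mul_nonneg (hf.nonneg _) (hf.nonneg _)
  rcases (hf.nonneg d).eq_or_lt with h0 | hd
  · rw [← h0, mul_zero]; exact mul_nonneg (hf.nonneg _) (hf.nonneg _)
  have hda : 0 < d - a := by linarith
  have hs : 0 < (d - b) / (d - a) := div_pos (by linarith) hda
  have ht : 0 < (b - a) / (d - a) := div_pos (by linarith) hda
  have hst : (d - b) / (d - a) + (b - a) / (d - a) = 1 := by field_simp; ring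
  set s := (d - b) / (d - a) with hs'
  set t := (b - a) / (d - a) with ht'
  have h1 := hf.logConcave a d s t hs ht hst
  have h2 := hf.logConcave a d t s ht hs (by linarith)
  have e1 : s * a + t * d = b := by rw [hs', ht']; field_simp; ring
  have e2 : t * a + s * d = c := by
    have : s * a + t * d + (t * a + s * d) = (s + t) * (a + d) := by ring
    rw [hst] at this; linarith
  rw [e1] at h1
  rw [e2] at h2
  calc f a * f d = (f a ^ s * f d ^ t) * (f a ^ t * f d ^ s) := by
        have e3 : f a = f a ^ s * f a ^ t := by rw [← Real.rpow_add ha, hst, Real.rpow_one]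
        have e4 : f d = f d ^ s * f d ^ t := by rw [← Real.rpow_add hd, hst, Real.rpow_one]
        nth_rewrite 1 [e3, e4]; ring
    _ ≤ f b * f c := mul_le_mul h1 h2 (by positivity) (hf.nonneg _)

theorem comp_neg (hf : IsLogConcaveProfile f) : IsLogConcaveProfile fun x => f (-x) where
  nonneg x := hf.nonneg _
  measurable := hf.measurable.comp measurable_neg
  bounded := hf.bounded.imp fun M h x => h _
  support := hf.support.imp fun R h x hx => h _ (by rwa [abs_neg])
  logConcave x y s t hs ht hst := by
    convert hf.logConcave (-x) (-y) s t hs ht hst using 2; ring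

theorem integrable_mul (hf : IsLogConcaveProfile f) {g : ℝ → ℝ} (hg : Continuous g) :
    Integrable fun x => g x * f x := by
  obtain ⟨M, hM⟩ := hf.bounded
  obtain ⟨R, hR⟩ := hf.support
  have h1 : IntegrableOn g (Icc (-R) R) := hg.integrableOn_Icc
  have h2 : IntegrableOn (fun x => g x * f x) (Icc (-R) R) :=
    h1.mul_bdd (c := M) hf.measurable.aestronglyMeasurable
      (ae_of_all _ fun x => by rw [Real.norm_of_nonneg (hf.nonneg x)]; exact hM x)
  refine (integrableOn_iff_integrable_of_support_subset ?_).1 h2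
  intro x hx
  by_contra hx'
  refine hx ?_
  have : R < |x| := by
    by_contra hle
    exact hx' (abs_le.1 (not_lt.1 hle))
  simp [hR x this]

theorem integrable (hf : IsLogConcaveProfile f) : Integrable f := by
  simpa using hf.integrable_mul (g := fun _ => 1) continuous_const

theorem half_line_moments (hf : IsLogConcaveProfile f) :
    f 0 * ∫ t in Ioi 0, t * f t ≤ (∫ t in Ioi 0, f t) ^ 2 ∧
    (∫ t in Ioi 0, f t) * ∫ t in Ioi 0, t ^ 2 * f t ≤ 2 * (∫ t in Ioi 0, t * f t) ^ 2 := by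
  set g : ℝ → ℝ≥0∞ := fun t => ENNReal.ofReal (f t) with hg'
  have hg : Measurable g := hf.measurable.ennreal_ofReal
  have h4 : ∀ a b c d, a ≤ b → a ≤ c → a + d = b + c → g a * g d ≤ g b * g c := by
    intro a b c d hab hac h
    simp only [hg']
    rw [← ENNReal.ofReal_mul (hf.nonneg _), ← ENNReal.ofReal_mul (hf.nonneg _)]
    exact ENNReal.ofReal_le_ofReal (hf.four_point hab hac h)
  have nn : ∀ k : ℕ, ∀ᵐ t ∂(volume.restrict (Ioi (0:ℝ))), 0 ≤ t ^ k * f t := fun k =>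
    (ae_restrict_mem measurableSet_Ioi).mono fun t ht =>
      mul_nonneg (pow_nonneg (le_of_lt ht) _) (hf.nonneg t)
  have conv : ∀ k : ℕ, ENNReal.ofReal (∫ t in Ioi 0, t ^ k * f t) =
      ∫⁻ t in Ioi 0, ENNReal.ofReal (t ^ k) * g t := by
    intro k
    rw [ofReal_integral_eq_lintegral_ofReal (hf.integrable_mul (by fun_prop)).integrableOn (nn k)]
    refine setLIntegral_congr_fun measurableSet_Ioi fun t ht => ?_
    simp only [hg']
    rw [ENNReal.ofReal_mul (pow_nonneg (le_of_lt ht) _)]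
  have c0 := conv 0
  have c1 := conv 1
  have c2 := conv 2
  simp only [pow_zero, one_mul, ENNReal.ofReal_one, pow_one] at c0 c1
  have n0 : 0 ≤ ∫ t in Ioi 0, f t := by simpa using integral_nonneg_of_ae (nn 0)
  have n1 : 0 ≤ ∫ t in Ioi 0, t * f t := by simpa using integral_nonneg_of_ae (nn 1)
  constructor
  · have := mul_lintegral_id_mul_le_sq hg fun s hs t ht =>
      h4 0 s t (s + t) hs.le ht.le (by ring)
    rw [← c0, ← c1, ← ENNReal.ofReal_mul (hf.nonneg _), ← ENNReal.ofReal_pow n0] at this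
    exact (ENNReal.ofReal_le_ofReal_iff (by positivity)).1 this
  · have hF : Measurable fun x => ∫⁻ t in Ioi x, g t :=
      Antitone.measurable fun a b hab => lintegral_mono_set (Ioi_subset_Ioi hab)
    have := mul_lintegral_id_mul_le_sq hF fun s hs t ht => tail_mul_tail_le hg h4 hs ht
    rw [lintegral_id_mul_tail hg, lintegral_tail hg, ← c0, ← c1] at this
    have e : ∫⁻ t in Ioi 0, ENNReal.ofReal (t ^ 2 / 2) * g t =
        ENNReal.ofReal ((1 / 2) * ∫ t in Ioi 0, t ^ 2 * f t) := by
      rw [ENNReal.ofReal_mul (by norm_num), c2, ← lintegral_const_mul _ (by fun_prop)]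
      refine lintegral_congr fun t => ?_
      rw [← mul_assoc, ← ENNReal.ofReal_mul (p := 1 / 2) (by norm_num)]
      congr 2
      ring
    rw [e, ← ENNReal.ofReal_mul n0, ← ENNReal.ofReal_pow n1,
      ENNReal.ofReal_le_ofReal_iff (by positivity)] at this
    linarith

/-- For a centered log-concave function, `f(0)² ∫ t² f ≤ (∫ f)³ / 2`. -/
theorem sq_mul_second_moment_le (hf : IsLogConcaveProfile f) (hc : ∫ t, t * f t = 0) :
    f 0 ^ 2 * ∫ t, t ^ 2 * f t ≤ (∫ t, f t) ^ 3 / 2 := by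
  have hfn := hf.comp_neg
  obtain ⟨a1, a2⟩ := hf.half_line_moments
  obtain ⟨b1, b2⟩ := hfn.half_line_moments
  have split : ∀ g : ℝ → ℝ, Continuous g →
      ∫ t, g t * f t = (∫ t in Ioi 0, g (-t) * f (-t)) + ∫ t in Ioi 0, g t * f t := by
    intro g hg
    rw [integral_comp_neg_Ioi (f := fun t => g t * f t), neg_zero]
    have := integral_add_compl measurableSet_Iic (hf.integrable_mul hg) (s := Iic 0)
    rw [compl_Iic] at this
    exact this.symm
  have s0 := split (fun _ => 1) continuous_const
  have s1 := split (fun t => t) continuous_id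
  have s2 := split (fun t => t ^ 2) (by fun_prop)
  simp only [one_mul] at s0
  simp only [even_two, Even.neg_pow] at s2
  simp only [neg_mul, integral_neg] at s1
  rw [hc] at s1
  rw [neg_zero] at b1
  have n0 : 0 ≤ ∫ t in Ioi 0, f t := integral_nonneg hf.nonneg
  have n0' : 0 ≤ ∫ t in Ioi 0, f (-t) := integral_nonneg hfn.nonneg
  have n1 : 0 ≤ ∫ t in Ioi 0, t * f t := setIntegral_nonneg measurableSet_Ioi fun t ht =>
    mul_nonneg (le_of_lt ht) (hf.nonneg t)
  rw [s0, s2]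
  -- Centering enters only here: both halves have the same first moment `m`.
  have hm : ∫ t in Ioi 0, t * f (-t) = ∫ t in Ioi 0, t * f t := by linarith
  rw [hm] at b1 b2
  have z2 : ∀ u : ℝ → ℝ, IsLogConcaveProfile u → ∫ t in Ioi 0, u t = 0 →
      ∫ t in Ioi 0, t ^ 2 * u t = 0 := by
    intro u hu h0
    rw [integral_eq_zero_iff_of_nonneg hu.nonneg hu.integrable.integrableOn] at h0
    refine integral_eq_zero_of_ae (h0.mono fun t ht => ?_)
    simp only [Pi.zero_apply] at ht ⊢
    rw [ht, mul_zero]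
  have z2p := z2 _ hf
  have z2q := z2 _ hfn
  generalize ∫ t in Ioi 0, f t = p at *
  generalize ∫ t in Ioi 0, f (-t) = q at *
  generalize ∫ t in Ioi 0, t * f t = m at *
  generalize ∫ t in Ioi 0, t ^ 2 * f t = s at *
  generalize ∫ t in Ioi 0, t ^ 2 * f (-t) = s' at *
  have hf0 := hf.nonneg 0
  generalize f 0 = a at *
  have key : ∀ x y σ : ℝ, 0 ≤ x → 0 ≤ y → a * m ≤ x ^ 2 → a * m ≤ y ^ 2 → x * σ ≤ 2 * m ^ 2 →
      (x = 0 → σ = 0) → a ^ 2 * σ ≤ 2 * x * y ^ 2 := by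
    intro x y σ hx hy h1 h2 h3 h4
    rcases hx.eq_or_lt with rfl | hx
    · simp [h4 rfl]
    have : x * (a ^ 2 * σ) ≤ x * (2 * x * y ^ 2) :=
      calc x * (a ^ 2 * σ) = a ^ 2 * (x * σ) := by ring
        _ ≤ a ^ 2 * (2 * m ^ 2) := by gcongr
        _ = 2 * ((a * m) * (a * m)) := by ring
        _ ≤ 2 * (x ^ 2 * y ^ 2) := by gcongr
        _ = x * (2 * x * y ^ 2) := by ring
    exact le_of_mul_le_mul_left this hx
  -- Since `a * m` is at most the square of each half mass, the smaller mass controls both halves.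
  -- If `p ≤ q`, then `a² s ≤ 2 p³` and `a² q s' ≤ 2 p⁴`; after multiplication by `q` the claim
  -- reduces to `4 p³ ≤ q (p + q)²`.
  rcases le_total p q with hpq | hpq
  · have k1 := key p p s n0 n0 a1 a1 a2 z2p
    have k2 : a ^ 2 * (q * s') ≤ 2 * p ^ 2 * p ^ 2 :=
      calc a ^ 2 * (q * s') ≤ a ^ 2 * (2 * m ^ 2) := by gcongr
        _ = 2 * ((a * m) * (a * m)) := by ring
        _ ≤ 2 * (p ^ 2 * p ^ 2) := by gcongr
        _ = _ := by ring
    rcases n0'.eq_or_lt with hq | hq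
    · rw [z2q hq.symm]
      rw [← hq] at hpq ⊢
      have : p = 0 := le_antisymm hpq n0
      simp [z2p this, this]
    have : q * (a ^ 2 * (s' + s)) ≤ q * ((q + p) ^ 3 / 2) := by
      have k1' : q * (a ^ 2 * s) ≤ q * (2 * p * p ^ 2) := by gcongr
      have : q * ((q + p) ^ 3 / 2) - (2 * p ^ 2 * p ^ 2 + q * (2 * p * p ^ 2)) =
        (q + p) * (q * (q + p) ^ 2 / 2 - 2 * p ^ 3) := by ring
      have h5 : 2 * p ^ 3 ≤ q * (q + p) ^ 2 / 2 := by
        have : p * (p + p) ^ 2 / 2 ≤ q * (q + p) ^ 2 / 2 := by gcongr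
        linarith [this]
      have h6 : 0 ≤ (q + p) * (q * (q + p) ^ 2 / 2 - 2 * p ^ 3) :=
        mul_nonneg (by linarith) (by linarith)
      linarith
    exact le_of_mul_le_mul_left this hq
  · have k1 := key q q s' n0' n0' b1 b1 b2 z2q
    have k2 : a ^ 2 * (p * s) ≤ 2 * q ^ 2 * q ^ 2 :=
      calc a ^ 2 * (p * s) ≤ a ^ 2 * (2 * m ^ 2) := by gcongr
        _ = 2 * ((a * m) * (a * m)) := by ring
        _ ≤ 2 * (q ^ 2 * q ^ 2) := by gcongr
        _ = _ := by ring
    rcases n0.eq_or_lt with hq | hq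
    · rw [z2p hq.symm]
      rw [← hq] at hpq ⊢
      have : q = 0 := le_antisymm hpq n0'
      simp [z2q this, this]
    have : p * (a ^ 2 * (s' + s)) ≤ p * ((q + p) ^ 3 / 2) := by
      have k1' : p * (a ^ 2 * s') ≤ p * (2 * q * q ^ 2) := by gcongr
      have : p * ((q + p) ^ 3 / 2) - (2 * q ^ 2 * q ^ 2 + p * (2 * q * q ^ 2)) =
        (q + p) * (p * (q + p) ^ 2 / 2 - 2 * q ^ 3) := by ring
      have h5 : 2 * q ^ 3 ≤ p * (q + p) ^ 2 / 2 := by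
        have : q * (q + q) ^ 2 / 2 ≤ p * (q + p) ^ 2 / 2 := by gcongr
        linarith [this]
      have h6 : 0 ≤ (q + p) * (p * (q + p) ^ 2 / 2 - 2 * q ^ 3) :=
        mul_nonneg (by linarith) (by linarith)
      linarith
    exact le_of_mul_le_mul_left this hq

end IsLogConcaveProfile

/-! ### The lower bound for the central value of a centered log-concave function -/

theorem exp_le_quartic {z : ℝ} (hz : |z| ≤ 7 / 5) :
    Real.exp z ≤ 1 + z + z ^ 2 / 2 + z ^ 3 / 6 + z ^ 4 / 8 := by
  set w := z / 2 with hw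
  have hzw : z = w + w := by rw [hw]; ring
  have hw1 : |w| ≤ 7 / 10 := by rw [hw, abs_div, abs_two]; linarith
  -- The Taylor remainder is taken at `z / 2`, where the argument is below one as `Real.exp_bound`
  -- requires, and the bound is then squared; `5 / 96` is its constant for four terms.
  have hb := Real.exp_bound (x := w) (by linarith) (n := 4) (by norm_num)
  simp only [Finset.sum_range_succ, Finset.sum_range_zero, Nat.factorial] at hb
  norm_num at hb
  have h4 : |w| ^ 4 = w ^ 4 := by
    rw [← abs_pow]; exact abs_of_nonneg (by positivity)
  rw [h4] at hb
  have hle := (abs_le.1 hb).2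
  obtain ⟨hl, hu⟩ := abs_le.1 hw1
  set P := 1 + w + w ^ 2 / 2 + w ^ 3 / 6 + w ^ 4 * (5 / 96) with hP
  have hwP : Real.exp w ≤ P := by rw [hP]; linarith
  have hsq : Real.exp z ≤ P ^ 2 := by
    rw [hzw, Real.exp_add, sq]
    exact mul_le_mul hwP hwP (Real.exp_pos _).le ((Real.exp_pos _).le.trans hwP)
  refine hsq.trans ?_
  rw [hzw]
  have hw2 : w ^ 2 ≤ 49 / 100 := by nlinarith
  have hid : 1 + (w + w) + (w + w) ^ 2 / 2 + (w + w) ^ 3 / 6 + (w + w) ^ 4 / 8 - P ^ 2 =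
      w ^ 4 * (2 - 11 / 16 - 13 / 48 * w - w ^ 2 * (23 / 288) - w ^ 2 * w * (5 / 288)
        - w ^ 2 * w ^ 2 * (25 / 9216)) := by rw [hP]; ring
  have hpos : 0 ≤ 2 - 11 / 16 - 13 / 48 * w - w ^ 2 * (23 / 288) - w ^ 2 * w * (5 / 288)
        - w ^ 2 * w ^ 2 * (25 / 9216) := by
    have h2 : w ^ 2 * w ≤ 1 := by nlinarith [sq_nonneg w]
    have h3 : w ^ 2 * w ^ 2 ≤ 1 := by nlinarith [sq_nonneg w]
    linarith
  have : 0 ≤ w ^ 4 * (2 - 11 / 16 - 13 / 48 * w - w ^ 2 * (23 / 288) - w ^ 2 * w * (5 / 288)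
        - w ^ 2 * w ^ 2 * (25 / 9216)) := mul_nonneg (by positivity) hpos
  linarith

/-- This is the numerical inequality to which the constant `1 / 12` reduces. The exponential on the
left is replaced by a quartic majorant, whose odd terms integrate to zero, and the one on the right
by its quadratic minorant. The bound `37 / 5` is just above `e²`, the range of `c²` that occurs. -/
theorem integral_parabola_mul_exp_le {c : ℝ} (hc : c ^ 2 ≤ 37 / 5) :
    ∫ x in (-(1 / 2 : ℝ))..(1 / 2), (1 / 4 - x ^ 2) * Real.exp (c * x) ≤
      Real.exp (c ^ 2 / 12) * (1 / 6 - c ^ 2 / 144) := by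
  have hc' : |c| ≤ 14 / 5 := abs_le_of_sq_le_sq (by linarith) (by norm_num)
  have h1 : ∫ x in (-(1 / 2 : ℝ))..(1 / 2), (1 / 4 - x ^ 2) * Real.exp (c * x) ≤
      ∫ x in (-(1 / 2 : ℝ))..(1 / 2), (1 / 4 - x ^ 2) *
        (1 + c * x + (c * x) ^ 2 / 2 + (c * x) ^ 3 / 6 + (c * x) ^ 4 / 8) := by
    refine intervalIntegral.integral_mono_on (by norm_num)
      (Continuous.intervalIntegrable (by fun_prop) _ _)
      (Continuous.intervalIntegrable (by fun_prop) _ _) fun x hx => ?_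
    have hx' : |x| ≤ 1 / 2 := abs_le.2 hx
    refine mul_le_mul_of_nonneg_left (exp_le_quartic ?_) ?_
    · rw [abs_mul]
      calc |c| * |x| ≤ 14 / 5 * (1 / 2) := by gcongr
        _ = 7 / 5 := by norm_num
    · nlinarith [hx.1, hx.2]
  have h2 : ∫ x in (-(1 / 2 : ℝ))..(1 / 2), (1 / 4 - x ^ 2) *
        (1 + c * x + (c * x) ^ 2 / 2 + (c * x) ^ 3 / 6 + (c * x) ^ 4 / 8) =
      1 / 6 + c ^ 2 / 240 + c ^ 4 / 8960 := by
    have hd : ∀ x ∈ uIcc (-(1 / 2 : ℝ)) (1 / 2), HasDerivAt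
        (fun x => x / 4 + c * x ^ 2 / 8 + (c ^ 2 / 8 - 1) * x ^ 3 / 3 + (c ^ 3 / 24 - c) * x ^ 4 / 4
          + (c ^ 4 / 32 - c ^ 2 / 2) * x ^ 5 / 5 - c ^ 3 / 6 * x ^ 6 / 6 - c ^ 4 / 8 * x ^ 7 / 7)
        ((1 / 4 - x ^ 2) *
          (1 + c * x + (c * x) ^ 2 / 2 + (c * x) ^ 3 / 6 + (c * x) ^ 4 / 8)) x := by
      intro x _
      have hp : ∀ (k : ℕ) (b d : ℝ), HasDerivAt (fun x : ℝ => b * x ^ k / d)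
          (b * (k * x ^ (k - 1)) / d) x := fun k b d =>
        ((hasDerivAt_pow k x).const_mul b).div_const d
      refine ((((((((hasDerivAt_id x).div_const 4).add (hp 2 c 8)).add
        (hp 3 (c ^ 2 / 8 - 1) 3)).add (hp 4 (c ^ 3 / 24 - c) 4)).add
        (hp 5 (c ^ 4 / 32 - c ^ 2 / 2) 5)).sub (hp 6 (c ^ 3 / 6) 6)).sub
        (hp 7 (c ^ 4 / 8) 7)).congr_deriv ?_
      push_cast
      ring
    rw [intervalIntegral.integral_eq_sub_of_hasDerivAt hd
      (Continuous.intervalIntegrable (by fun_prop) _ _)]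
    ring
  rw [h2] at h1
  refine h1.trans ?_
  have hs : 0 ≤ c ^ 2 := sq_nonneg c
  have he := Real.quadratic_le_exp_of_nonneg (x := c ^ 2 / 12) (by positivity)
  have h3 : (1 + c ^ 2 / 12 + (c ^ 2 / 12) ^ 2 / 2) * (1 / 6 - c ^ 2 / 144) ≤
      Real.exp (c ^ 2 / 12) * (1 / 6 - c ^ 2 / 144) := by
    gcongr
    linarith
  refine le_trans ?_ h3
  rw [show c ^ 4 = c ^ 2 * c ^ 2 by ring]
  generalize c ^ 2 = s at *
  have : (1 + s / 12 + (s / 12) ^ 2 / 2) * (1 / 6 - s / 144) - (1 / 6 + s / 240 + s * s / 8960) =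
      s * (1 / 360 - s / 8960 - s ^ 2 / 41472) := by ring
  have h5 : 0 ≤ 1 / 360 - s / 8960 - s ^ 2 / 41472 := by nlinarith
  have := mul_nonneg hs h5
  linarith

namespace IsLogConcaveProfile

variable {f : ℝ → ℝ}

theorem integrable_id_mul (hf : IsLogConcaveProfile f) : Integrable fun x => x * f x :=
  hf.integrable_mul continuous_id

theorem integrable_sq_mul (hf : IsLogConcaveProfile f) : Integrable fun x => x ^ 2 * f x :=
  hf.integrable_mul (by fun_prop)

theorem exists_neg_pos (hf : IsLogConcaveProfile f) (hc : ∫ t, t * f t = 0) (hm : 0 < ∫ t, f t) :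
    ∃ x < 0, 0 < f x := by
  by_contra! hcon
  have h0 : ∀ t, 0 ≤ t * f t := by
    intro t
    rcases lt_or_ge t 0 with ht | ht
    · rw [le_antisymm (hcon t ht) (hf.nonneg t), mul_zero]
    · exact mul_nonneg ht (hf.nonneg t)
  rw [integral_eq_zero_iff_of_nonneg h0 (hf.integrable_id_mul)] at hc
  refine hm.ne' (integral_eq_zero_of_ae ?_)
  have hne : ∀ᵐ t : ℝ, t ≠ 0 := by simp [ae_iff]
  filter_upwards [hc, hne] with t ht ht0
  simpa [ht0] using ht

theorem exists_pos_pos (hf : IsLogConcaveProfile f) (hc : ∫ t, t * f t = 0) (hm : 0 < ∫ t, f t) :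
    ∃ x > 0, 0 < f x := by
  obtain ⟨x, hx, hfx⟩ := hf.comp_neg.exists_neg_pos
    (by
      have := integral_neg_eq_self (fun t => t * f t) volume
      rw [hc] at this
      simpa [integral_neg] using this)
    (by rwa [integral_neg_eq_self f volume])
  exact ⟨-x, by linarith, hfx⟩

/-- Chords of the concave function `log f` issuing from the origin have smaller slope on the right
than on the left. -/
theorem slope_le (hf : IsLogConcaveProfile f) {u v : ℝ} (hu : 0 < u) (hv : v < 0)
    (hfu : 0 < f u) (hfv : 0 < f v) :
    (Real.log (f u) - Real.log (f 0)) / u ≤ (Real.log (f v) - Real.log (f 0)) / v := by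
  have hd : 0 < u - v := by linarith
  have h := hf.logConcave v u (u / (u - v)) (-v / (u - v)) (by positivity)
    (div_pos (by linarith) hd) (by field_simp; ring)
  rw [show u / (u - v) * v + -v / (u - v) * u = 0 by ring] at h
  have h' := Real.log_le_log (by positivity) h
  rw [Real.log_mul (by positivity) (by positivity), Real.log_rpow hfv, Real.log_rpow hfu] at h'
  rw [div_le_iff₀ hu, div_mul_eq_mul_div, le_div_iff_of_neg hv]
  have h2 : u * Real.log (f v) - v * Real.log (f u) ≤ (u - v) * Real.log (f 0) := by
    have := mul_le_mul_of_nonneg_left h' hd.le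
    calc u * Real.log (f v) - v * Real.log (f u)
        = (u - v) * (u / (u - v) * Real.log (f v) + -v / (u - v) * Real.log (f u)) := by
          field_simp; ring
      _ ≤ _ := this
  linarith

/-- A centered log-concave function is positive at the origin. -/
theorem zero_pos (hf : IsLogConcaveProfile f) (hc : ∫ t, t * f t = 0) (hm : 0 < ∫ t, f t) :
    0 < f 0 := by
  obtain ⟨v, hv, hfv⟩ := hf.exists_neg_pos hc hm
  obtain ⟨u, hu, hfu⟩ := hf.exists_pos_pos hc hm
  have hd : 0 < u - v := by linarith
  have h := hf.logConcave v u (u / (u - v)) (-v / (u - v)) (by positivity)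
    (div_pos (by linarith) hd) (by field_simp; ring)
  rw [show u / (u - v) * v + -v / (u - v) * u = 0 by ring] at h
  exact lt_of_lt_of_le (by positivity) h

/-- A supporting line of `log f` at the origin. Its slope is the supremum of the right chord slopes,
which is finite because mass on the left supplies an upper bound. -/
theorem exists_exp_bound (hf : IsLogConcaveProfile f) (hc : ∫ t, t * f t = 0)
    (hm : 0 < ∫ t, f t) : ∃ c : ℝ, ∀ t, f t ≤ f 0 * Real.exp (c * t) := by
  obtain ⟨v, hv, hfv⟩ := hf.exists_neg_pos hc hm
  obtain ⟨u, hu, hfu⟩ := hf.exists_pos_pos hc hm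
  have h0 := hf.zero_pos hc hm
  set S := {r : ℝ | ∃ t, 0 < t ∧ 0 < f t ∧ (Real.log (f t) - Real.log (f 0)) / t = r}
  have hne : S.Nonempty := ⟨_, u, hu, hfu, rfl⟩
  have hub : ∀ w < 0, 0 < f w →
      (Real.log (f w) - Real.log (f 0)) / w ∈ upperBounds S := by
    rintro w hw hfw _ ⟨t, ht, hft, rfl⟩
    exact hf.slope_le ht hw hft hfw
  refine ⟨sSup S, fun t => ?_⟩
  rcases (hf.nonneg t).eq_or_lt with h | hft
  · rw [← h]; positivity
  suffices Real.log (f t) - Real.log (f 0) ≤ sSup S * t by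
    rw [← Real.exp_log hft]
    calc Real.exp (Real.log (f t)) ≤ Real.exp (Real.log (f 0) + sSup S * t) :=
          Real.exp_le_exp.2 (by linarith)
      _ = _ := by rw [Real.exp_add, Real.exp_log h0]
  rcases lt_trichotomy t 0 with ht | rfl | ht
  · have := csSup_le hne (hub t ht hft)
    rwa [le_div_iff_of_neg ht] at this
  · simp
  · have := le_csSup ⟨_, hub v hv hfv⟩ ⟨t, ht, hft, rfl⟩
    rwa [div_le_iff₀ ht] at this

/-- Testing `f` against `1 / c - t` gives exactly `1 / c` by centering. Keeping only the part where
the test function is positive and replacing `f` by the exponential there gives at most `e / c²`. -/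
theorem le_exp_one_of_le_exp (hf : IsLogConcaveProfile f) (hc : ∫ t, t * f t = 0)
    (hm : ∫ t, f t = 1) {c : ℝ} (hcf : ∀ t, f t ≤ Real.exp (c * t)) : c ≤ Real.exp 1 := by
  rcases le_or_gt c 0 with h | hc0
  · exact h.trans (Real.exp_pos _).le
  obtain ⟨R', hR'⟩ := hf.support
  set R := max R' 0
  have hR : ∀ x, R < |x| → f x = 0 := fun x hx => hR' x ((le_max_left _ _).trans_lt hx)
  have hR0 : 0 ≤ R := le_max_right _ _
  have hle : -R ≤ 1 / c := by have : 0 < 1 / c := by positivity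
                              linarith
  have h1 : ∫ t, (1 / c - t) * f t = 1 / c := by
    have : ∀ t, (1 / c - t) * f t = 1 / c * f t - t * f t := fun t => by ring
    simp_rw [this]
    rw [integral_sub (hf.integrable.const_mul _) (hf.integrable_id_mul),
      integral_const_mul, hm, hc]
    ring
  have h2 : ∫ t, (1 / c - t) * f t ≤
      ∫ t in Ioc (-R) (1 / c), (1 / c - t) * Real.exp (c * t) := by
    rw [← integral_indicator measurableSet_Ioc]
    refine integral_mono_ae (hf.integrable_mul (by fun_prop)) ?_ ?_
    · exact (Continuous.integrableOn_Icc (by fun_prop)).mono_set Ioc_subset_Icc_self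
        |>.integrable_indicator measurableSet_Ioc
    · have hne : ∀ᵐ t : ℝ, t ≠ -R := by simp [ae_iff]
      filter_upwards [hne] with t htR
      by_cases ht : t ∈ Ioc (-R) (1 / c)
      · rw [indicator_of_mem ht]
        exact mul_le_mul_of_nonneg_left (hcf t) (by linarith [ht.2])
      · rw [indicator_of_notMem ht]
        rcases le_or_gt t (1 / c) with h | h
        · have htR' : t < -R := lt_of_le_of_ne (not_lt.1 fun h' => ht ⟨h', h⟩) htR
          rw [hR t (by rw [abs_of_neg (by linarith)]; linarith), mul_zero]
        · exact mul_nonpos_of_nonpos_of_nonneg (by linarith) (hf.nonneg t)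
  have h3 : ∫ t in Ioc (-R) (1 / c), (1 / c - t) * Real.exp (c * t) ≤ Real.exp 1 / c ^ 2 := by
    rw [← intervalIntegral.integral_of_le hle]
    have hd : ∀ t ∈ uIcc (-R) (1 / c), HasDerivAt
        (fun t => (2 / c ^ 2 - t / c) * Real.exp (c * t))
        ((1 / c - t) * Real.exp (c * t)) t := by
      intro t _
      have e1 : HasDerivAt (fun t : ℝ => Real.exp (c * t)) (Real.exp (c * t) * c) t := by
        simpa using ((hasDerivAt_id t).const_mul c).exp
      have e2 : HasDerivAt (fun t : ℝ => 2 / c ^ 2 - t / c) (-(1 / c)) t := by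
        simpa using ((hasDerivAt_id t).div_const c).const_sub (2 / c ^ 2)
      refine (e2.mul e1).congr_deriv ?_
      field_simp
      ring
    rw [intervalIntegral.integral_eq_sub_of_hasDerivAt hd
      (Continuous.intervalIntegrable (by fun_prop) _ _)]
    have e3 : 0 ≤ (2 / c ^ 2 - -R / c) * Real.exp (c * -R) := by
      rw [neg_div, sub_neg_eq_add]; positivity
    have e4 : (2 / c ^ 2 - 1 / c / c) * Real.exp (c * (1 / c)) = Real.exp 1 / c ^ 2 := by
      rw [mul_one_div_cancel hc0.ne']; field_simp; norm_num
    linarith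
  rw [h1] at h2
  have h4 := h2.trans h3
  rw [div_le_div_iff₀ hc0 (by positivity)] at h4
  nlinarith

/-- A bathtub argument: testing `f` against a parabola turns a lower bound on the second moment into
an upper bound on the integral of the parabola. That integral is largest when `f` is replaced by its
exponential majorant on the interval where the parabola is positive. The shift by `c / 12` centers
this truncated exponential to first order in `c`; for `c = 0` the comparison density is uniform on
`[-1/2, 1/2]`, hence the constant. -/
theorem one_div_twelve_le (hf : IsLogConcaveProfile f) (hc : ∫ t, t * f t = 0)
    (hm : ∫ t, f t = 1) {c : ℝ} (hcf : ∀ t, f t ≤ Real.exp (c * t)) :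
    1 / 12 ≤ ∫ t, t ^ 2 * f t := by
  -- The slope bound is applied to `f` and to its reflection, so `|c| ≤ e`.
  have hce : c ^ 2 ≤ 37 / 5 := by
    have h1 := hf.le_exp_one_of_le_exp hc hm hcf
    have h2 := hf.comp_neg.le_exp_one_of_le_exp
      (by
        have := integral_neg_eq_self (fun t => t * f t) volume
        rw [hc] at this
        simpa [integral_neg] using this)
      (by rwa [integral_neg_eq_self f volume]) (c := -c) (fun t => by simpa using hcf (-t))
    have h3 := Real.exp_one_lt_d9
    have : |c| ≤ 2.7182818286 := abs_le.2 ⟨by linarith, by linarith⟩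
    have h4 := sq_le_sq' (abs_le.1 this).1 (abs_le.1 this).2
    refine h4.trans (by norm_num)
  have h1 : ∫ t, (1 / 4 - (t + c / 12) ^ 2) * f t =
      1 / 4 - c ^ 2 / 144 - ∫ t, t ^ 2 * f t := by
    have : ∀ t, (1 / 4 - (t + c / 12) ^ 2) * f t =
        (1 / 4 - c ^ 2 / 144) * f t - c / 6 * (t * f t) - t ^ 2 * f t := fun t => by ring
    simp_rw [this]
    have hI : Integrable fun t => (1 / 4 - c ^ 2 / 144) * f t - c / 6 * (t * f t) :=
      (hf.integrable.const_mul _).sub (hf.integrable_id_mul.const_mul _)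
    rw [integral_sub hI hf.integrable_sq_mul,
      integral_sub (hf.integrable.const_mul _) ((hf.integrable_id_mul).const_mul _),
      integral_const_mul, integral_const_mul, hm, hc]
    ring
  have h2 : ∫ t, (1 / 4 - (t + c / 12) ^ 2) * f t ≤
      ∫ t in Ioc (-(1 / 2) - c / 12) (1 / 2 - c / 12),
        (1 / 4 - (t + c / 12) ^ 2) * Real.exp (c * t) := by
    rw [← integral_indicator measurableSet_Ioc]
    refine integral_mono (hf.integrable_mul (by fun_prop)) ?_ ?_
    · exact (Continuous.integrableOn_Icc (by fun_prop)).mono_set Ioc_subset_Icc_self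
        |>.integrable_indicator measurableSet_Ioc
    · intro t
      by_cases ht : t ∈ Ioc (-(1 / 2) - c / 12) (1 / 2 - c / 12)
      · rw [indicator_of_mem ht]
        refine mul_le_mul_of_nonneg_left (hcf t) ?_
        nlinarith [ht.1, ht.2]
      · rw [indicator_of_notMem ht]
        refine mul_nonpos_of_nonpos_of_nonneg ?_ (hf.nonneg t)
        by_contra! h
        have : (t + c / 12) ^ 2 < (1 / 2) ^ 2 := by linarith
        obtain ⟨ha, hb⟩ := abs_lt.1 (abs_lt_of_sq_lt_sq this (by norm_num))
        exact ht ⟨by linarith, by linarith⟩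
  have h3 : ∫ t in Ioc (-(1 / 2) - c / 12) (1 / 2 - c / 12),
        (1 / 4 - (t + c / 12) ^ 2) * Real.exp (c * t) =
      Real.exp (-(c ^ 2 / 12)) *
        ∫ x in (-(1 / 2 : ℝ))..(1 / 2), (1 / 4 - x ^ 2) * Real.exp (c * x) := by
    rw [← intervalIntegral.integral_of_le (by linarith), ← intervalIntegral.integral_const_mul]
    have := intervalIntegral.integral_comp_add_right (a := -(1 / 2) - c / 12) (b := 1 / 2 - c / 12)
      (fun x => Real.exp (-(c ^ 2 / 12)) * ((1 / 4 - x ^ 2) * Real.exp (c * x))) (c / 12)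
    rw [show -(1 / 2) - c / 12 + c / 12 = -(1 / 2 : ℝ) by ring,
      show 1 / 2 - c / 12 + c / 12 = (1 / 2 : ℝ) by ring] at this
    rw [← this]
    refine intervalIntegral.integral_congr fun t _ => ?_
    rw [mul_left_comm, ← Real.exp_add]
    congr 2
    ring
  have h4 := mul_le_mul_of_nonneg_left (integral_parabola_mul_exp_le hce)
    (Real.exp_pos (-(c ^ 2 / 12))).le
  rw [← mul_assoc, ← Real.exp_add, neg_add_cancel, Real.exp_zero, one_mul] at h4
  linarith

theorem rescale (hf : IsLogConcaveProfile f) {a r : ℝ} (ha : 0 < a) (hr : 0 < r) :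
    IsLogConcaveProfile fun x => a⁻¹ * f (r * x) where
  nonneg x := mul_nonneg (by positivity) (hf.nonneg _)
  measurable := (hf.measurable.comp (measurable_const_mul r)).const_mul _
  bounded := by
    obtain ⟨M, hM⟩ := hf.bounded
    exact ⟨a⁻¹ * M, fun x => by gcongr; exact hM _⟩
  support := by
    obtain ⟨R, hR⟩ := hf.support
    refine ⟨R / r, fun x hx => ?_⟩
    rw [hR (r * x) (by rw [abs_mul, abs_of_pos hr, mul_comm]; exact (div_lt_iff₀ hr).1 hx),
      mul_zero]
  logConcave x y s t hs ht hst := by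
    rw [Real.mul_rpow (by positivity) (hf.nonneg _), Real.mul_rpow (by positivity) (hf.nonneg _)]
    have h := hf.logConcave (r * x) (r * y) s t hs ht hst
    have e : a⁻¹ ^ s * a⁻¹ ^ t = a⁻¹ := by
      rw [← Real.rpow_add (by positivity), hst, Real.rpow_one]
    calc a⁻¹ ^ s * f (r * x) ^ s * (a⁻¹ ^ t * f (r * y) ^ t)
        = (a⁻¹ ^ s * a⁻¹ ^ t) * (f (r * x) ^ s * f (r * y) ^ t) := by ring
      _ ≤ a⁻¹ * f (s * (r * x) + t * (r * y)) := by rw [e]; gcongr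
      _ = _ := by congr 2; ring

/-- For a centered log-concave function, `f(0)² ∫ t² f ≥ (∫ f)³ / 12`. -/
theorem le_sq_mul_second_moment (hf : IsLogConcaveProfile f) (hc : ∫ t, t * f t = 0)
    (hm : 0 < ∫ t, f t) : (∫ t, f t) ^ 3 / 12 ≤ f 0 ^ 2 * ∫ t, t ^ 2 * f t := by
  have h0 := hf.zero_pos hc hm
  obtain ⟨c, hcf⟩ := hf.exists_exp_bound hc hm
  set M := ∫ t, f t with hM
  set a := f 0 with ha
  -- With dilation factor `M / a` and amplitude `1 / a`, the rescaled function has both central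
  -- value and mass equal to one.
  have hr : 0 < M / a := by positivity
  have hg := hf.rescale h0 hr
  have sub : ∀ k : ℕ, ∫ x, x ^ k * (a⁻¹ * f (M / a * x)) =
      a⁻¹ * (M / a)⁻¹ ^ (k + 1) * ∫ t, t ^ k * f t := by
    intro k
    have := Measure.integral_comp_mul_left (fun t => a⁻¹ * (M / a)⁻¹ ^ k * (t ^ k * f t)) (M / a)
    rw [abs_of_pos (by positivity), integral_const_mul (f := fun t => t ^ k * f t), smul_eq_mul]
      at this
    rw [pow_succ]
    calc _ = ∫ x, a⁻¹ * (M / a)⁻¹ ^ k * ((M / a * x) ^ k * f (M / a * x)) := by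
          refine integral_congr_ae (ae_of_all _ fun x => ?_)
          simp only
          rw [mul_pow, inv_pow]
          field_simp
      _ = _ := by rw [this]; ring
  have s0 := sub 0
  have s1 := sub 1
  have s2 := sub 2
  simp only [pow_zero, one_mul, zero_add, pow_one] at s0 s1
  rw [hc, mul_zero] at s1
  have := hg.one_div_twelve_le s1 (by rw [s0, ← hM]; field_simp) (c := c * (M / a)) fun t => by
    have := hcf (M / a * t)
    rw [← mul_assoc] at this
    rw [inv_mul_le_iff₀ h0]
    exact this
  rw [s2] at this
  have e : a⁻¹ * (M / a)⁻¹ ^ (2 + 1) = a ^ 2 / M ^ 3 := by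
    rw [inv_div, div_pow]; field_simp
  rw [e, div_mul_eq_mul_div, le_div_iff₀ (by positivity)] at this
  linarith

end IsLogConcaveProfile

/-! ### Sections of a convex body by parallel hyperplanes -/

section Sections

variable {n : ℕ}

/-- The splitting `(t, y) ↦ t w + y` of `ℝⁿ` into the line spanned by a unit vector `w` and its
orthogonal complement. -/
def lineSplit (w : E n) (hw : ‖w‖ = 1) : WithLp 2 (ℝ × (Submodule.span ℝ {w})ᗮ) ≃ₗᵢ[ℝ] E n where
  toFun p := p.fst • w + (p.snd : E n)
  invFun x := WithLp.toLp 2 (inner ℝ w x, (Submodule.span ℝ {w})ᗮ.orthogonalProjectionOnto x)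
  map_add' p q := by simp [add_smul]; abel
  map_smul' c p := by simp [mul_smul]
  left_inv p := by
    have h0 : inner ℝ w (p.snd : E n) = 0 :=
      Submodule.mem_orthogonal_singleton_iff_inner_right.1 p.snd.2
    have h1 : (Submodule.span ℝ {w})ᗮ.orthogonalProjectionOnto w = 0 := by
      rw [Submodule.orthogonalProjectionOnto_orthogonal_apply_eq_zero]
      exact Submodule.mem_span_singleton_self w
    refine (WithLp.equiv 2 _).injective ?_
    simp [inner_add_right, inner_smul_right, hw, h0, h1]
    rfl
  right_inv x := by
    have := (Submodule.span ℝ {w}).starProjection_add_starProjection_orthogonal x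
    rw [Submodule.starProjection_unit_singleton ℝ hw] at this
    exact this
  norm_map' p := by
    have h0 : inner ℝ w (p.snd : E n) = 0 :=
      Submodule.mem_orthogonal_singleton_iff_inner_right.1 p.snd.2
    have h1 := norm_add_sq_eq_norm_sq_add_norm_sq_of_inner_eq_zero (p.fst • w) (p.snd : E n)
      (by rw [inner_smul_left, h0, mul_zero])
    have h2 := WithLp.prod_norm_sq_eq_of_L2 p
    rw [← sq_eq_sq₀ (norm_nonneg _) (norm_nonneg _), h2, sq]
    change ‖p.fst • w + (p.snd : E n)‖ * ‖p.fst • w + (p.snd : E n)‖ = _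
    rw [h1, norm_smul, hw]
    simp [sq]

theorem measurePreserving_lineSplit (w : E n) (hw : ‖w‖ = 1) :
    MeasurePreserving (fun p : ℝ × (Submodule.span ℝ {w})ᗮ => p.1 • w + (p.2 : E n)) :=
  (lineSplit w hw).measurePreserving.comp (WithLp.volume_preserving_toLp _ _)

/-- The measure of the section of `K` by the hyperplane `{x | ⟨x, w⟩ = t}`. -/
def sectionProfile (K : Set (E n)) (w : E n) (t : ℝ) : ℝ :=
  volume.real {y : (Submodule.span ℝ {w})ᗮ | t • w + (y : E n) ∈ K}

theorem norm_le_of_split {w : E n} (hw : ‖w‖ = 1) (t : ℝ) (y : (Submodule.span ℝ {w})ᗮ) :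
    |t| ≤ ‖t • w + (y : E n)‖ ∧ ‖y‖ ≤ ‖t • w + (y : E n)‖ := by
  have h0 : inner ℝ w (y : E n) = 0 :=
    Submodule.mem_orthogonal_singleton_iff_inner_right.1 y.2
  have h1 := norm_add_sq_eq_norm_sq_add_norm_sq_of_inner_eq_zero (t • w) (y : E n)
    (by rw [inner_smul_left, h0, mul_zero])
  rw [norm_smul, hw, mul_one, Real.norm_eq_abs] at h1
  constructor
  · refine abs_le_of_sq_le_sq (?_ : t ^ 2 ≤ _) (norm_nonneg _)
    have := abs_mul_abs_self t
    nlinarith [mul_self_nonneg ‖(y : E n)‖]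
  · refine (abs_le_of_sq_le_sq (a := ‖y‖) ?_ (norm_nonneg _)).trans' (le_abs_self _)
    have : ‖(y : E n)‖ = ‖y‖ := rfl
    rw [this] at h1
    nlinarith [mul_self_nonneg |t|]

theorem isCompact_section {K : Set (E n)} (hK : IsCompact K) (w : E n) (t : ℝ) :
    IsCompact {y : (Submodule.span ℝ {w})ᗮ | t • w + (y : E n) ∈ K} := by
  have hi : Isometry fun y : (Submodule.span ℝ {w})ᗮ => t • w + (y : E n) :=
    (isometry_add_left (t • w)).comp isometry_subtype_coe
  exact hi.isClosedEmbedding.isCompact_preimage hK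

theorem sectionVolume_eq {K : Set (E n)} (hK : IsCompact K) (w : E n) :
    sectionVolume K w = ENNReal.ofReal (sectionProfile K w 0) := by
  rw [sectionProfile, measureReal_def,
    ENNReal.ofReal_toReal (isCompact_section hK w 0).measure_lt_top.ne]
  simp [sectionVolume]

theorem measurableSet_split {K : Set (E n)} (hK : IsCompact K) (w : E n) :
    MeasurableSet {p : ℝ × (Submodule.span ℝ {w})ᗮ | p.1 • w + (p.2 : E n) ∈ K} :=
  (hK.isClosed.preimage (f := fun p : ℝ × (Submodule.span ℝ {w})ᗮ => p.1 • w + (p.2 : E n))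
    (by fun_prop)).measurableSet

theorem isLogConcaveProfile_sectionProfile {K : Set (E n)} (hK : IsCompact K) (hc : Convex ℝ K)
    {w : E n} (hw : ‖w‖ = 1) : IsLogConcaveProfile (sectionProfile K w) where
  nonneg _ := measureReal_nonneg
  measurable := (measurable_measure_prodMk_left
    (ν := (volume : Measure (Submodule.span ℝ {w})ᗮ)) (measurableSet_split hK w)).ennreal_toReal
  bounded := by
    obtain ⟨R, hR⟩ := hK.isBounded.exists_norm_le
    refine ⟨volume.real (Metric.closedBall (0 : (Submodule.span ℝ {w})ᗮ) R), fun t => ?_⟩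
    refine measureReal_mono (fun y hy => ?_) (isCompact_closedBall _ _).measure_lt_top.ne
    rw [mem_closedBall_zero_iff]
    exact (norm_le_of_split hw t y).2.trans (hR _ hy)
  support := by
    obtain ⟨R, hR⟩ := hK.isBounded.exists_norm_le
    refine ⟨R, fun t ht => ?_⟩
    have : {y : (Submodule.span ℝ {w})ᗮ | t • w + (y : E n) ∈ K} = ∅ := by
      ext y
      simp only [mem_ofPred_eq, mem_empty_iff_false, iff_false]
      exact fun hy => not_lt.2 ((norm_le_of_split hw t y).1.trans (hR _ hy)) ht
    rw [sectionProfile, this]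
    simp
  logConcave x y s t hs ht hst := by
    refine brunn_minkowski (isCompact_section hK w x) (isCompact_section hK w y)
      (isCompact_section hK w _) hs ht hst fun u hu v hv => ?_
    have := hc hu hv hs.le ht.le hst
    simp only [mem_ofPred_eq]
    convert this using 1
    simp only [Submodule.coe_add, Submodule.coe_smul]
    module

theorem setIntegral_inner_eq {K : Set (E n)} (hK : IsCompact K) {w : E n} (hw : ‖w‖ = 1)
    {φ : ℝ → ℝ} (hφ : Continuous φ) :
    ∫ x in K, φ (inner ℝ x w) = ∫ t, φ t * sectionProfile K w t := by
  have hmp := measurePreserving_lineSplit w hw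
  set g : E n → ℝ := K.indicator fun x => φ (inner ℝ x w) with hg
  have hgi : Integrable g :=
    ((Continuous.continuousOn (by fun_prop)).integrableOn_compact hK).integrable_indicator
      hK.measurableSet
  rw [← integral_indicator hK.measurableSet, ← hg]
  have h1 : ∫ x, g x = ∫ p : ℝ × (Submodule.span ℝ {w})ᗮ, g (p.1 • w + (p.2 : E n)) := by
    rw [← hmp.map_eq, integral_map hmp.measurable.aemeasurable]
    rw [hmp.map_eq]
    exact hgi.aestronglyMeasurable
  rw [h1, Measure.volume_eq_prod, integral_prod (fun p : ℝ × (Submodule.span ℝ {w})ᗮ => g (p.1 • w + (p.2 : E n)))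
    (hmp.integrable_comp_of_integrable hgi)]
  refine integral_congr_ae (ae_of_all _ fun t => ?_)
  have h2 : ∀ y : (Submodule.span ℝ {w})ᗮ, g (t • w + (y : E n)) =
      {y : (Submodule.span ℝ {w})ᗮ | t • w + (y : E n) ∈ K}.indicator (fun _ => φ t) y := by
    intro y
    have h0 : inner ℝ (y : E n) w = 0 :=
      Submodule.mem_orthogonal_singleton_iff_inner_left.1 y.2
    have h3 : inner ℝ (t • w + (y : E n)) w = t := by
      rw [inner_add_left, h0, inner_smul_left, real_inner_self_eq_norm_sq, hw]; simp
    simp only [hg, indicator, mem_ofPred_eq, h3]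
  simp only [h2]
  rw [integral_indicator_const _ (isCompact_section hK w t).measurableSet, smul_eq_mul, mul_comm]
  rfl

theorem volume_real_pos {K : Set (E n)} (hK : IsConvexBody K) : 0 < volume.real K :=
  ENNReal.toReal_pos (Measure.measure_pos_of_nonempty_interior _ hK.interior_nonempty).ne'
    hK.isCompact.measure_lt_top.ne

theorem setIntegral_inner_eq_zero {K : Set (E n)} (hK : IsConvexBody K) (hc : IsCentered K)
    (y : E n) : ∫ x in K, inner ℝ x y = 0 := by
  have h0 : ∫ x in K, x = 0 := by
    have := hc
    rw [IsCentered, barycentre, smul_eq_zero] at this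
    exact this.resolve_left (inv_ne_zero (volume_real_pos hK).ne')
  have h1 : IntegrableOn (fun x : E n => x) K := continuous_id.continuousOn.integrableOn_compact
    hK.isCompact
  have := integral_inner (𝕜 := ℝ) h1 y
  simp_rw [real_inner_comm y]
  rw [this, h0, inner_zero_right]

/-- Central sections of a centered convex body: for a unit vector `w` the quantity
`|K ∩ w^⊥|² ∫_K ⟨x, w⟩² dx` lies between `|K|³ / 12` and `|K|³ / 2`. -/
theorem sectionProfile_bounds {K : Set (E n)} (hK : IsConvexBody K) (hc : IsCentered K)
    {w : E n} (hw : ‖w‖ = 1) : 0 < sectionProfile K w 0 ∧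
      volume.real K ^ 3 / 12 ≤ sectionProfile K w 0 ^ 2 * ∫ x in K, (inner ℝ x w) ^ 2 ∧
      sectionProfile K w 0 ^ 2 * ∫ x in K, (inner ℝ x w) ^ 2 ≤ volume.real K ^ 3 / 2 := by
  have hf := isLogConcaveProfile_sectionProfile hK.isCompact hK.convex hw
  have h0 : volume.real K = ∫ t, sectionProfile K w t := by
    have := setIntegral_inner_eq hK.isCompact hw (φ := fun _ => 1) continuous_const
    simpa using this
  have h1 := setIntegral_inner_eq hK.isCompact hw continuous_id
  have h2 := setIntegral_inner_eq hK.isCompact hw (φ := fun t => t ^ 2) (by fun_prop)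
  simp only [id] at h1
  rw [setIntegral_inner_eq_zero hK hc] at h1
  have hm : 0 < ∫ t, sectionProfile K w t := h0 ▸ volume_real_pos hK
  rw [h0, h2]
  exact ⟨hf.zero_pos h1.symm hm, hf.le_sq_mul_second_moment h1.symm hm,
    hf.sq_mul_second_moment_le h1.symm⟩

end Sections

/-! ### The covariance operator and the isotropic constant -/

section Covariance

variable {n : ℕ}

/-- The covariance operator `|K|⁻¹ ∫_K x ⊗ x dx - b ⊗ b`, with `b` the barycentre of `K`. -/
def covOp (K : Set (E n)) : E n →L[ℝ] E n :=
  (volume.real K)⁻¹ • (∫ x in K, InnerProductSpace.rankOne ℝ x x) -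
    InnerProductSpace.rankOne ℝ (barycentre K) (barycentre K)

theorem integrableOn_of_continuous {K : Set (E n)} (hK : IsCompact K) {F : Type*}
    [NormedAddCommGroup F] {g : E n → F} (hg : Continuous g) : IntegrableOn g K :=
  hg.continuousOn.integrableOn_compact hK

theorem continuous_rankOne_self :
    Continuous fun x : E n => InnerProductSpace.rankOne ℝ x x := by
  have h : ∀ x : E n, InnerProductSpace.rankOne ℝ x x =
      ContinuousLinearMap.smulRightL ℝ (E n) (E n) (innerSL ℝ x) x := by
    intro x
    ext1 y
    simp
  simp only [h]
  exact (ContinuousLinearMap.smulRightL ℝ (E n) (E n)).continuous₂.comp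
    ((innerSL ℝ).continuous.prodMk continuous_id)

theorem inner_covOp {K : Set (E n)} (hK : IsCompact K) (y z : E n) :
    inner ℝ (covOp K y) z = (volume.real K)⁻¹ * (∫ x in K, inner ℝ x y * inner ℝ x z) -
      inner ℝ (barycentre K) y * inner ℝ (barycentre K) z := by
  have hi : IntegrableOn (fun x : E n => InnerProductSpace.rankOne ℝ x x) K :=
    integrableOn_of_continuous hK continuous_rankOne_self
  have hi2 : IntegrableOn (fun x : E n => (inner ℝ x y : ℝ) • x) K :=
    integrableOn_of_continuous hK (by fun_prop)
  simp only [covOp, _root_.sub_apply, _root_.smul_apply,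
    InnerProductSpace.rankOne_apply, inner_sub_left, real_inner_smul_left]
  rw [ContinuousLinearMap.integral_apply hi]
  simp only [InnerProductSpace.rankOne_apply]
  rw [real_inner_comm, ← integral_inner hi2]
  simp only [real_inner_smul_right]
  simp only [real_inner_comm z]

theorem isSymmetric_covOp {K : Set (E n)} (hK : IsCompact K) :
    (covOp K : E n →ₗ[ℝ] E n).IsSymmetric := by
  intro y z
  rw [ContinuousLinearMap.coe_coe, real_inner_comm (covOp K z) y, inner_covOp hK, inner_covOp hK]
  simp only [mul_comm]

/-- Polarization: it reduces identities between covariance operators to computations of variances.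
-/
theorem eq_of_inner_self_eq {A B : E n →ₗ[ℝ] E n} (hA : A.IsSymmetric) (hB : B.IsSymmetric)
    (h : ∀ y, inner ℝ (A y) y = inner ℝ (B y) y) : A = B := by
  rw [← sub_eq_zero, ← (hA.sub hB).inner_map_self_eq_zero]
  intro y
  rw [LinearMap.sub_apply, inner_sub_left, h, sub_self]

theorem setIntegral_affine_image {K : Set (E n)} (hK : IsCompact K) (a : E n)
    (T : E n ≃ₗ[ℝ] E n) {F : Type*} [NormedAddCommGroup F] [NormedSpace ℝ F] (g : E n → F) :
    ∫ x in (fun x => a + T x) '' K, g x =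
      |LinearMap.det (T : E n →ₗ[ℝ] E n)| • ∫ x in K, g (a + T x) := by
  have := integral_image_eq_integral_abs_det_fderiv_smul volume hK.measurableSet
    (f := fun x => a + T x)
    (f' := fun _ => LinearMap.toContinuousLinearMap (T : E n →ₗ[ℝ] E n))
    (fun x _ => ((LinearMap.toContinuousLinearMap
      (T : E n →ₗ[ℝ] E n)).hasFDerivAt.const_add a).hasFDerivWithinAt)
    (fun x _ y _ hxy => T.injective (add_left_cancel hxy)) g
  rw [this, ← integral_smul]
  rfl

theorem isCompact_affine_image {K : Set (E n)} (hK : IsCompact K) (a : E n)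
    (T : E n ≃ₗ[ℝ] E n) : IsCompact ((fun x => a + T x) '' K) :=
  hK.image (continuous_const.add (LinearMap.continuous_of_finiteDimensional (T : E n →ₗ[ℝ] E n)))

theorem IsConvexBody.affine_image {K : Set (E n)} (hK : IsConvexBody K) (a : E n)
    (T : E n ≃ₗ[ℝ] E n) : IsConvexBody ((fun x => a + T x) '' K) where
  isCompact := isCompact_affine_image hK.isCompact a T
  convex := by
    have : (fun x => a + T x) '' K = (fun x => a + x) '' ((T : E n →ₗ[ℝ] E n) '' K) := by
      rw [image_image]; rfl
    rw [this]
    exact (hK.convex.linear_image _).translate a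
  interior_nonempty := by
    let h : E n ≃ₜ E n := T.toContinuousLinearEquiv.toHomeomorph.trans (Homeomorph.addLeft a)
    have : (fun x => a + T x) '' K = h '' K := rfl
    rw [this, ← h.image_interior]
    exact hK.interior_nonempty.image _

theorem volume_real_affine_image (K : Set (E n)) (a : E n) (T : E n ≃ₗ[ℝ] E n) :
    volume.real ((fun x => a + T x) '' K) =
      |LinearMap.det (T : E n →ₗ[ℝ] E n)| * volume.real K := by
  have : (fun x => a + T x) '' K = (fun x => a + x) '' ((T : E n →ₗ[ℝ] E n) '' K) := by
    rw [image_image]; rfl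
  rw [this, measureReal_def, image_add_left, measure_preimage_add,
    Measure.addHaar_image_linearMap, ENNReal.toReal_mul, ENNReal.toReal_ofReal (abs_nonneg _)]
  rfl

theorem det_ne_zero (T : E n ≃ₗ[ℝ] E n) : LinearMap.det (T : E n →ₗ[ℝ] E n) ≠ 0 :=
  (LinearEquiv.isUnit_det' T).ne_zero

theorem inner_barycentre {K : Set (E n)} (hK : IsCompact K) (y : E n) :
    inner ℝ (barycentre K) y = (volume.real K)⁻¹ * ∫ x in K, inner ℝ x y := by
  rw [barycentre, real_inner_smul_left, real_inner_comm,
    ← integral_inner (f := fun x => x) (integrableOn_of_continuous hK continuous_id)]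
  simp only [real_inner_comm y]

theorem barycentre_affine_image {K : Set (E n)} (hK : IsConvexBody K) (a : E n)
    (T : E n ≃ₗ[ℝ] E n) :
    barycentre ((fun x => a + T x) '' K) = a + T (barycentre K) := by
  have hv := volume_real_pos hK
  have hT : Continuous T := LinearMap.continuous_of_finiteDimensional (T : E n →ₗ[ℝ] E n)
  rw [barycentre, setIntegral_affine_image hK.isCompact, volume_real_affine_image,
    integral_add (integrableOn_of_continuous hK.isCompact continuous_const)
      (integrableOn_of_continuous hK.isCompact hT), barycentre, map_smul]
  have h1 : ∫ x in K, T x = T (∫ x in K, x) :=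
    (LinearMap.toContinuousLinearMap (T : E n →ₗ[ℝ] E n)).integral_comp_comm
      (integrableOn_of_continuous hK.isCompact continuous_id)
  have hd : |LinearMap.det (T : E n →ₗ[ℝ] E n)| ≠ 0 := abs_ne_zero.2 (det_ne_zero T)
  rw [h1, setIntegral_const, smul_smul, smul_add, smul_smul]
  rw [show (|LinearMap.det (T : E n →ₗ[ℝ] E n)| * volume.real K)⁻¹ *
    |LinearMap.det (T : E n →ₗ[ℝ] E n)| = (volume.real K)⁻¹ by field_simp,
    inv_mul_cancel₀ hv.ne', one_smul]

theorem covOp_affine_image {K : Set (E n)} (hK : IsConvexBody K) (a : E n)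
    (T : E n ≃ₗ[ℝ] E n) :
    (covOp ((fun x => a + T x) '' K) : E n →ₗ[ℝ] E n) =
      (T : E n →ₗ[ℝ] E n) ∘ₗ (covOp K : E n →ₗ[ℝ] E n) ∘ₗ
        LinearMap.adjoint (T : E n →ₗ[ℝ] E n) := by
  have hv := volume_real_pos hK
  have hd : |LinearMap.det (T : E n →ₗ[ℝ] E n)| ≠ 0 := abs_ne_zero.2 (det_ne_zero T)
  refine eq_of_inner_self_eq (isSymmetric_covOp (isCompact_affine_image hK.isCompact a T)) ?_ ?_
  · intro y z
    simp only [LinearMap.comp_apply]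
    rw [← LinearMap.adjoint_inner_right, isSymmetric_covOp hK.isCompact,
      LinearMap.adjoint_inner_left]
  intro y
  simp only [LinearMap.comp_apply]
  rw [← LinearMap.adjoint_inner_right (T : E n →ₗ[ℝ] E n)]
  set z := LinearMap.adjoint (T : E n →ₗ[ℝ] E n) y with hz
  have hTz : ∀ x, inner ℝ (T x) y = inner ℝ x z := fun x => by
    rw [hz, LinearMap.adjoint_inner_right]; rfl
  rw [ContinuousLinearMap.coe_coe, ContinuousLinearMap.coe_coe,
    inner_covOp (isCompact_affine_image hK.isCompact a T), inner_covOp hK.isCompact,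
    setIntegral_affine_image hK.isCompact, volume_real_affine_image, barycentre_affine_image hK]
  simp only [inner_add_left, hTz]
  have e : ∀ x : E n, (inner ℝ a y + inner ℝ x z) * (inner ℝ a y + inner ℝ x z) =
      inner ℝ a y ^ 2 + 2 * inner ℝ a y * inner ℝ x z + inner ℝ x z * inner ℝ x z := fun x => by
    ring
  have i1 : IntegrableOn (fun _ : E n => (inner ℝ a y : ℝ) ^ 2) K :=
    integrableOn_of_continuous hK.isCompact continuous_const
  have i2 : IntegrableOn (fun x : E n => 2 * (inner ℝ a y : ℝ) * inner ℝ x z) K :=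
    integrableOn_of_continuous hK.isCompact (by fun_prop)
  have i3 : IntegrableOn (fun x : E n => (inner ℝ x z * inner ℝ x z : ℝ)) K :=
    integrableOn_of_continuous hK.isCompact (by fun_prop)
  have i12 : IntegrableOn
      (fun x : E n => (inner ℝ a y : ℝ) ^ 2 + 2 * (inner ℝ a y : ℝ) * inner ℝ x z) K := i1.add i2
  simp only [e]
  rw [integral_add i12 i3, integral_add i1 i2, setIntegral_const, integral_const_mul,
    inner_barycentre hK.isCompact]
  simp only [smul_eq_mul]
  field_simp
  ring

theorem det_adjoint (T : E n →ₗ[ℝ] E n) : LinearMap.det (LinearMap.adjoint T) =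
    LinearMap.det T := by
  let b := EuclideanSpace.basisFun (Fin n) ℝ
  have h : ∀ S : E n →ₗ[ℝ] E n, (LinearMap.toMatrixOrthonormal b S).det = LinearMap.det S :=
    fun S => LinearMap.det_toMatrix b.toBasis S
  rw [← h, ← h, ← LinearMap.star_eq_adjoint, map_star, Matrix.star_eq_conjTranspose,
    Matrix.det_conjTranspose]
  simp

theorem det_covOp_affine_image {K : Set (E n)} (hK : IsConvexBody K) (a : E n)
    (T : E n ≃ₗ[ℝ] E n) :
    LinearMap.det (covOp ((fun x => a + T x) '' K) : E n →ₗ[ℝ] E n) =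
      LinearMap.det (T : E n →ₗ[ℝ] E n) ^ 2 * LinearMap.det (covOp K : E n →ₗ[ℝ] E n) := by
  rw [covOp_affine_image hK, LinearMap.det_comp, LinearMap.det_comp, det_adjoint]
  ring

theorem inner_covOp_self_of_isCentered {K : Set (E n)} (hK : IsCompact K) (hc : IsCentered K)
    (y : E n) : inner ℝ (covOp K y) y = (volume.real K)⁻¹ * ∫ x in K, (inner ℝ x y) ^ 2 := by
  rw [inner_covOp hK, hc, inner_zero_left, mul_zero, sub_zero]
  simp only [sq]

/-- For a centered body positivity follows from the lower estimate `|K|³ / 12`. The general case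
follows because the covariance is translation invariant and quadratic in `y`. -/
theorem inner_covOp_self_pos {K : Set (E n)} (hK : IsConvexBody K) {y : E n} (hy : y ≠ 0) :
    0 < inner ℝ (covOp K y) y := by
  have key : ∀ K : Set (E n), IsConvexBody K → IsCentered K → ∀ w : E n, ‖w‖ = 1 →
      0 < inner ℝ (covOp K w) w := by
    intro K hK hc w hw
    have hv := volume_real_pos hK
    rw [inner_covOp_self_of_isCentered hK.isCompact hc]
    obtain ⟨h0, h1, -⟩ := sectionProfile_bounds hK hc hw
    have h2 : 0 < sectionProfile K w 0 ^ 2 * ∫ x in K, (inner ℝ x w) ^ 2 :=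
      lt_of_lt_of_le (by positivity) h1
    have := (pos_iff_pos_of_mul_pos h2).1 (by positivity)
    positivity
  have key2 : ∀ w : E n, ‖w‖ = 1 → 0 < inner ℝ (covOp K w) w := by
    intro w hw
    have hc : IsCentered ((fun x => -barycentre K + LinearEquiv.refl ℝ (E n) x) '' K) := by
      rw [IsCentered, barycentre_affine_image hK]; simp
    have := key _ (hK.affine_image _ _) hc w hw
    rw [← ContinuousLinearMap.coe_coe, covOp_affine_image hK] at this
    simpa using this
  have hny : 0 < ‖y‖ := norm_pos_iff.2 hy
  have := key2 (‖y‖⁻¹ • y) (by rw [norm_smul, norm_inv, norm_norm, inv_mul_cancel₀ hny.ne'])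
  rw [map_smul, real_inner_smul_left, real_inner_smul_right] at this
  have h3 : inner ℝ (covOp K y) y = ‖y‖ ^ 2 * (‖y‖⁻¹ * (‖y‖⁻¹ * inner ℝ (covOp K y) y)) := by
    field_simp
  rw [h3]
  positivity

theorem IsIsotropicWith.covOp_eq {K : Set (E n)} {L : ℝ} (h : IsIsotropicWith K L) :
    (covOp K : E n →ₗ[ℝ] E n) = L ^ 2 • LinearMap.id := by
  have hK := h.isConvexBody
  have hv : volume.real K = 1 := by rw [measureReal_def, h.volume_eq_one]; rfl
  refine eq_of_inner_self_eq (isSymmetric_covOp hK.isCompact) ?_ fun y => ?_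
  · intro y z
    simp [real_inner_smul_left, real_inner_smul_right]
  rw [ContinuousLinearMap.coe_coe, inner_covOp_self_of_isCentered hK.isCompact h.isCentered, hv]
  simp only [LinearMap.smul_apply, LinearMap.id_apply, real_inner_smul_left]
  rw [real_inner_self_eq_norm_sq, inv_one, one_mul]
  rcases eq_or_ne y 0 with rfl | hy
  · simp
  have hny : 0 < ‖y‖ := norm_pos_iff.2 hy
  have := h.second_moment (‖y‖⁻¹ • y)
    (by rw [norm_smul, norm_inv, norm_norm, inv_mul_cancel₀ hny.ne'])
  simp only [real_inner_smul_right, mul_pow] at this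
  rw [integral_const_mul] at this
  rw [← this]
  field_simp

theorem IsIsotropicWith.det_covOp {K : Set (E n)} {L : ℝ} (h : IsIsotropicWith K L) :
    LinearMap.det (covOp K : E n →ₗ[ℝ] E n) = (L ^ n) ^ 2 := by
  rw [h.covOp_eq, LinearMap.det_smul, LinearMap.det_id, finrank_euclideanSpace_fin, mul_one]
  ring

/-- `det Cov / |K|²` is an affine invariant, and on an isotropic body it equals `L ^ (2n)`. The
right-hand side does not involve the affine image, which is why the isotropic constant is well
defined. -/
theorem pow_mul_volume_sq_eq {K : Set (E n)} (hK : IsConvexBody K) {L : ℝ} {a : E n}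
    {T : E n ≃ₗ[ℝ] E n} (h : IsIsotropicWith ((fun x => a + T x) '' K) L) :
    (L ^ n * volume.real K) ^ 2 = LinearMap.det (covOp K : E n →ₗ[ℝ] E n) := by
  have h1 := h.det_covOp
  have hv : volume.real ((fun x => a + T x) '' K) = 1 := by
    rw [measureReal_def, h.volume_eq_one]; rfl
  rw [volume_real_affine_image] at hv
  rw [det_covOp_affine_image hK] at h1
  rw [mul_pow, ← h1, ← sq_abs (LinearMap.det (T : E n →ₗ[ℝ] E n))]
  calc _ = (|LinearMap.det (T : E n →ₗ[ℝ] E n)| * volume.real K) ^ 2 *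
        LinearMap.det (covOp K : E n →ₗ[ℝ] E n) := by ring
    _ = _ := by rw [hv]; ring

/-- A positive definite operator is congruent to the identity. -/
theorem exists_congr_id {A : E n →ₗ[ℝ] E n} (hA : A.IsSymmetric)
    (hpos : ∀ y, y ≠ 0 → 0 < inner ℝ (A y) y) : ∃ T : E n ≃ₗ[ℝ] E n,
      (T : E n →ₗ[ℝ] E n) ∘ₗ A ∘ₗ LinearMap.adjoint (T : E n →ₗ[ℝ] E n) = LinearMap.id := by
  have hfr : Module.finrank ℝ (E n) = n := finrank_euclideanSpace_fin
  set w := hA.eigenvectorBasis hfr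
  set l := hA.eigenvalues hfr
  have hAw : ∀ i, A (w i) = l i • w i := fun i => hA.apply_eigenvectorBasis hfr i
  have hl : ∀ i, 0 < l i := fun i => by
    have := hpos (w i) (w.orthonormal.ne_zero i)
    rw [hAw, real_inner_smul_left, real_inner_self_eq_norm_sq, w.orthonormal.1 i] at this
    simpa using this
  have hc : ∀ i, 0 < (Real.sqrt (l i))⁻¹ := fun i => inv_pos.2 (Real.sqrt_pos.2 (hl i))
  -- In an eigenbasis `T` is the inverse square root of `A`.
  set c : Fin n → ℝ := fun i => (Real.sqrt (l i))⁻¹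
  let T : E n ≃ₗ[ℝ] E n := w.toBasis.equiv
    (w.toBasis.isUnitSMul (w := c) fun i => (hc i).ne'.isUnit) (Equiv.refl _)
  have hT : ∀ i, T (w i) = c i • w i := fun i => by
    have := w.toBasis.equiv_apply i
      (w.toBasis.isUnitSMul (w := c) fun i => (hc i).ne'.isUnit) (Equiv.refl _)
    rw [Module.Basis.isUnitSMul_apply] at this
    simpa using this
  have hT' : ∀ i, LinearMap.adjoint (T : E n →ₗ[ℝ] E n) (w i) = c i • w i := fun i => by
    refine InnerProductSpace.ext_inner_right_basis w.toBasis fun j => ?_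
    rw [LinearMap.adjoint_inner_left, OrthonormalBasis.coe_toBasis]
    rw [LinearEquiv.coe_coe, hT, real_inner_smul_left, real_inner_smul_right,
      w.inner_eq_ite]
    split_ifs with hij
    · rw [hij]
    · simp
  refine ⟨T, w.toBasis.ext fun i => ?_⟩
  simp only [OrthonormalBasis.coe_toBasis, LinearMap.comp_apply, hT', map_smul, hAw,
    LinearEquiv.coe_coe, hT, smul_smul, LinearMap.id_apply, mul_assoc]
  have : c i * (l i * c i) = 1 := by
    change (Real.sqrt (l i))⁻¹ * (l i * (Real.sqrt (l i))⁻¹) = 1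
    have h1 := Real.sq_sqrt (hl i).le
    have h2 := (Real.sqrt_pos.2 (hl i)).ne'
    field_simp
    linarith
  rw [this, one_smul]

theorem exists_isIsotropicWith (hn : 1 ≤ n) {K : Set (E n)} (hK : IsConvexBody K) :
    ∃ (L : ℝ) (a : E n) (T : E n ≃ₗ[ℝ] E n), IsIsotropicWith ((fun x => a + T x) '' K) L := by
  obtain ⟨T, hT⟩ := exists_congr_id (isSymmetric_covOp hK.isCompact)
    fun y hy => inner_covOp_self_pos hK hy
  have hv := volume_real_pos hK
  have hd : 0 < |LinearMap.det (T : E n →ₗ[ℝ] E n)| := abs_pos.2 (det_ne_zero T)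
  set d := |LinearMap.det (T : E n →ₗ[ℝ] E n)| with hd'
  -- `T` makes the covariance the identity; the extra dilation by `r` gives volume one and turns the
  -- covariance into `r² id`, so `r` is the isotropic constant.
  obtain ⟨r, hr, hrn⟩ : ∃ r : ℝ, 0 < r ∧ r ^ n * (d * volume.real K) = 1 := by
    refine ⟨((d * volume.real K)⁻¹) ^ (1 / (n : ℝ)), by positivity, ?_⟩
    rw [← Real.rpow_natCast, ← Real.rpow_mul (by positivity),
      one_div_mul_cancel (by positivity), Real.rpow_one, inv_mul_cancel₀ (by positivity)]
  let S : E n ≃ₗ[ℝ] E n := T.trans (LinearEquiv.smulOfNeZero ℝ (E n) r hr.ne')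
  have hS : (S : E n →ₗ[ℝ] E n) = r • (T : E n →ₗ[ℝ] E n) := rfl
  have hdS : |LinearMap.det (S : E n →ₗ[ℝ] E n)| = r ^ n * d := by
    rw [hS, LinearMap.det_smul, abs_mul, finrank_euclideanSpace_fin, abs_of_pos (by positivity)]
  have hcb := hK.affine_image (-S (barycentre K)) S
  have hvol : volume.real ((fun x => -S (barycentre K) + S x) '' K) = 1 := by
    rw [volume_real_affine_image, hdS, ← hrn]; ring
  have hcen : IsCentered ((fun x => -S (barycentre K) + S x) '' K) := by
    rw [IsCentered, barycentre_affine_image hK, neg_add_cancel]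
  refine ⟨r, -S (barycentre K), S, hcb, ?_, hcen, hr.le, fun θ hθ => ?_⟩
  · rw [measureReal_def] at hvol
    rw [← ENNReal.ofReal_toReal hcb.isCompact.measure_lt_top.ne, hvol, ENNReal.ofReal_one]
  · have h1 := inner_covOp_self_of_isCentered hcb.isCompact hcen θ
    rw [hvol, inv_one, one_mul] at h1
    rw [← h1, ← ContinuousLinearMap.coe_coe, covOp_affine_image hK, hS, map_smulₛₗ]
    have h2 : (r • (T : E n →ₗ[ℝ] E n)) ∘ₗ (covOp K : E n →ₗ[ℝ] E n) ∘ₗ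
        (r • LinearMap.adjoint (T : E n →ₗ[ℝ] E n)) = r ^ 2 • LinearMap.id := by
      rw [← hT]
      ext x : 1
      simp [smul_smul, sq]
    simp only [RCLike.conj_to_real] at h2 ⊢
    rw [h2, LinearMap.smul_apply, LinearMap.id_apply, real_inner_smul_left,
      real_inner_self_eq_norm_sq, hθ]
    simp

/-- The determinant formula makes the defining set a singleton. For `n = 0` the power `L ^ n` would
not determine `L`. -/
theorem IsIsotropicWith.isotropicConstant_eq (hn : 1 ≤ n) {K : Set (E n)} (hK : IsConvexBody K)
    {L : ℝ} {a : E n} {T : E n ≃ₗ[ℝ] E n} (h : IsIsotropicWith ((fun x => a + T x) '' K) L) :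
    isotropicConstant K = L := by
  have hv := volume_real_pos hK
  have : {L : ℝ | ∃ (a : E n) (T : E n ≃ₗ[ℝ] E n),
      IsIsotropicWith ((fun x => a + T x) '' K) L} = {L} := by
    ext M
    simp only [mem_ofPred_eq, mem_singleton_iff]
    constructor
    · rintro ⟨b, S, h'⟩
      have e := (pow_mul_volume_sq_eq hK h').trans (pow_mul_volume_sq_eq hK h).symm
      have hM := h'.nonneg
      have hL := h.nonneg
      have e1 := (sq_eq_sq₀ (by positivity) (by positivity)).1 e
      have e2 := mul_right_cancel₀ hv.ne' e1
      exact (pow_left_inj₀ hM hL (by omega)).1 e2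
    · rintro rfl
      exact ⟨a, T, h⟩
  rw [isotropicConstant, this, csInf_singleton]

theorem exists_isIsotropicWith_isotropicConstant (hn : 1 ≤ n) {K : Set (E n)}
    (hK : IsConvexBody K) : ∃ (a : E n) (T : E n ≃ₗ[ℝ] E n),
      IsIsotropicWith ((fun x => a + T x) '' K) (isotropicConstant K) := by
  obtain ⟨L, a, T, h⟩ := exists_isIsotropicWith hn hK
  exact ⟨a, T, by rwa [h.isotropicConstant_eq hn hK]⟩

/-- The isotropic constant is determined by `L_K^{2n} |K|² = det Cov(K)`. -/
theorem isotropicConstant_spec (hn : 1 ≤ n) {K : Set (E n)} (hK : IsConvexBody K) :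
    0 ≤ isotropicConstant K ∧ (isotropicConstant K ^ n * volume.real K) ^ 2 =
      LinearMap.det (covOp K : E n →ₗ[ℝ] E n) := by
  obtain ⟨a, T, h⟩ := exists_isIsotropicWith_isotropicConstant hn hK
  exact ⟨h.nonneg, pow_mul_volume_sq_eq hK h⟩

end Covariance

/-! ### Principal axes of the inertia ellipsoid -/

section PrincipalAxes

variable {n : ℕ}

theorem inertiaSupport_eq {K : Set (E n)} (hK : IsConvexBody K) (hc : IsCentered K) (y : E n) :
    inertiaSupport K y = Real.sqrt (inner ℝ (covOp K y) y) := by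
  rw [inertiaSupport, inner_covOp_self_of_isCentered hK.isCompact hc]

theorem inner_covOp_self_nonneg {K : Set (E n)} (hK : IsConvexBody K) (y : E n) :
    0 ≤ inner ℝ (covOp K y) y := by
  rcases eq_or_ne y 0 with rfl | hy
  · simp
  · exact (inner_covOp_self_pos hK hy).le

theorem inner_covOp_comm {K : Set (E n)} (hK : IsCompact K) (y z : E n) :
    inner ℝ (covOp K y) z = inner ℝ (covOp K z) y := by
  rw [real_inner_comm y]
  exact isSymmetric_covOp hK y z

/-- Cauchy–Schwarz for the covariance form; it shows that `Cov y`, suitably normalized, belongs to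
`Z₂(K)`. -/
theorem inner_covOp_sq_le {K : Set (E n)} (hK : IsConvexBody K) (y z : E n) :
    inner ℝ (covOp K y) z ^ 2 ≤ inner ℝ (covOp K y) y * inner ℝ (covOp K z) z := by
  rcases eq_or_ne z 0 with rfl | hz
  · simp
  have h1 := inner_covOp_self_pos hK hz
  set α := inner ℝ (covOp K z) z
  set β := inner ℝ (covOp K y) z with hβ
  have h2 := inner_covOp_self_nonneg hK (α • y - β • z)
  have h3 : inner ℝ (covOp K (α • y - β • z)) (α • y - β • z) =
      α * (inner ℝ (covOp K y) y * α - β ^ 2) := by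
    simp only [map_sub, map_smul, inner_sub_left, inner_sub_right, real_inner_smul_left,
      real_inner_smul_right]
    rw [inner_covOp_comm hK.isCompact z y, ← hβ]
    ring
  rw [h3] at h2
  linarith [(mul_nonneg_iff_of_pos_left h1).1 h2]

theorem inner_eq_sum (w : OrthonormalBasis (Fin n) ℝ (E n)) (x y : E n) :
    inner ℝ x y = ∑ i, inner ℝ x (w i) * inner ℝ y (w i) := by
  rw [← w.sum_inner_mul_inner x y]
  simp only [real_inner_comm]

theorem sq_inner_le (w : OrthonormalBasis (Fin n) ℝ (E n)) {r : Fin n → ℝ} (hr : ∀ i, 0 < r i)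
    {x : E n} (hx : ∑ i, (inner ℝ x (w i) / r i) ^ 2 ≤ 1) (y : E n) :
    inner ℝ x y ^ 2 ≤ ∑ i, r i ^ 2 * inner ℝ y (w i) ^ 2 := by
  have h1 := Finset.sum_mul_sq_le_sq_mul_sq Finset.univ (fun i => inner ℝ x (w i) / r i)
    (fun i => r i * inner ℝ y (w i))
  have h2 : ∀ i, inner ℝ x (w i) / r i * (r i * inner ℝ y (w i)) =
      inner ℝ x (w i) * inner ℝ y (w i) := fun i => by
    have := (hr i).ne'
    field_simp
  simp only [h2, ← inner_eq_sum] at h1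
  refine h1.trans ?_
  simp only [mul_pow]
  exact mul_le_of_le_one_left (Finset.sum_nonneg fun i _ => by positivity) hx

theorem inertiaEllipsoid_eq {K : Set (E n)} (hK : IsConvexBody K) (hc : IsCentered K)
    (w : OrthonormalBasis (Fin n) ℝ (E n)) {r : Fin n → ℝ} (hr : ∀ i, 0 < r i)
    (h : ∀ y, inner ℝ (covOp K y) y = ∑ i, r i ^ 2 * inner ℝ y (w i) ^ 2) :
    inertiaEllipsoid K = {x : E n | ∑ i, (inner ℝ x (w i) / r i) ^ 2 ≤ 1} := by
  ext x
  simp only [inertiaEllipsoid, mem_ofPred_eq, inertiaSupport_eq hK hc, h]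
  constructor
  · intro hx
    set S := ∑ i, (inner ℝ x (w i) / r i) ^ 2 with hS
    -- The direction in which the support inequality is decisive: it reads `S ≤ √S`, hence `S ≤ 1`.
    set y : E n := ∑ i, (inner ℝ x (w i) / r i ^ 2) • w i with hy
    have hyi : ∀ i, inner ℝ y (w i) = inner ℝ x (w i) / r i ^ 2 := fun i => by
      rw [hy, real_inner_comm, w.orthonormal.inner_right_fintype]
    have h1 : inner ℝ x y = S := by
      rw [inner_eq_sum w, hS]
      refine Finset.sum_congr rfl fun i _ => ?_
      rw [hyi, div_pow]; ring
    have h2 : ∑ i, r i ^ 2 * inner ℝ y (w i) ^ 2 = S := by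
      rw [hS]
      refine Finset.sum_congr rfl fun i _ => ?_
      have := (hr i).ne'
      rw [hyi]; field_simp
    have h3 := hx y
    rw [h1, h2] at h3
    have hS0 : 0 ≤ S := Finset.sum_nonneg fun i _ => sq_nonneg _
    have h4 : S * S ≤ S := by
      calc S * S ≤ Real.sqrt S * Real.sqrt S := by gcongr
        _ = S := Real.mul_self_sqrt hS0
    nlinarith
  · intro hx y
    exact Real.le_sqrt_of_sq_le (sq_inner_le w hr hx y)

/-- Principal axes are given through the set `Z₂(K)` alone, so the quadratic form must be recovered
from it. The two inequalities come from two contact points in direction `y`: the normalized `Cov y`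
lies in `Z₂(K)` and attains `√q`, while the contact point `z` of the given ellipsoid attains `√g`.
-/
theorem inner_covOp_self_eq_sum {K : Set (E n)} (hK : IsConvexBody K) (hc : IsCentered K)
    (w : OrthonormalBasis (Fin n) ℝ (E n)) {r : Fin n → ℝ} (hr : ∀ i, 0 < r i)
    (h : inertiaEllipsoid K = {x : E n | ∑ i, (inner ℝ x (w i) / r i) ^ 2 ≤ 1}) (y : E n) :
    inner ℝ (covOp K y) y = ∑ i, r i ^ 2 * inner ℝ y (w i) ^ 2 := by
  have hmem : ∀ x, x ∈ inertiaEllipsoid K ↔ ∑ i, (inner ℝ x (w i) / r i) ^ 2 ≤ 1 := by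
    intro x; rw [h]; rfl
  rcases eq_or_ne y 0 with rfl | hy
  · simp
  have hq := inner_covOp_self_pos hK hy
  set q := inner ℝ (covOp K y) y with hq'
  have hsq := Real.sqrt_pos.2 hq
  have hq2 := Real.sq_sqrt hq.le
  set g := ∑ i, r i ^ 2 * inner ℝ y (w i) ^ 2 with hg'
  have hle : q ≤ g := by
    have hx : (Real.sqrt q)⁻¹ • covOp K y ∈ inertiaEllipsoid K := by
      intro z
      rw [inertiaSupport_eq hK hc, real_inner_smul_left]
      refine Real.le_sqrt_of_sq_le ?_
      rw [mul_pow, inv_pow, hq2, inv_mul_le_iff₀ hq]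
      exact inner_covOp_sq_le hK y z
    have := sq_inner_le w hr ((hmem _).1 hx) y
    rw [real_inner_smul_left, ← hq', mul_pow, inv_pow, hq2] at this
    calc q = q⁻¹ * q ^ 2 := by field_simp
      _ ≤ g := this
  have hg : 0 < g := hq.trans_le hle
  have hg2 := Real.sq_sqrt hg.le
  have hsg := Real.sqrt_pos.2 hg
  refine le_antisymm hle ?_
  set z : E n := ∑ i, ((Real.sqrt g)⁻¹ * (r i ^ 2 * inner ℝ y (w i))) • w i with hz
  have hzi : ∀ i, inner ℝ z (w i) = (Real.sqrt g)⁻¹ * (r i ^ 2 * inner ℝ y (w i)) := fun i => by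
    rw [hz, real_inner_comm, w.orthonormal.inner_right_fintype]
  have hzm : z ∈ inertiaEllipsoid K := by
    rw [hmem]
    have : ∑ i, (inner ℝ z (w i) / r i) ^ 2 = g⁻¹ * g := by
      nth_rewrite 2 [hg']
      rw [Finset.mul_sum]
      refine Finset.sum_congr rfl fun i _ => ?_
      have := (hr i).ne'
      rw [hzi]
      nth_rewrite 2 [← hg2]
      field_simp
    rw [this, inv_mul_cancel₀ hg.ne']
  have h1 := hzm y
  rw [inertiaSupport_eq hK hc, ← hq', inner_eq_sum w] at h1
  have h2 : ∑ i, inner ℝ z (w i) * inner ℝ y (w i) = (Real.sqrt g)⁻¹ * g := by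
    nth_rewrite 2 [hg']
    rw [Finset.mul_sum]
    refine Finset.sum_congr rfl fun i _ => ?_
    rw [hzi]; ring
  have h3 : (Real.sqrt g)⁻¹ * g = Real.sqrt g := by
    nth_rewrite 2 [← hg2]; field_simp
  rw [h2, h3] at h1
  exact (Real.sqrt_le_sqrt_iff hq.le).1 h1

theorem covOp_apply_axis {K : Set (E n)} (hK : IsCompact K)
    (w : OrthonormalBasis (Fin n) ℝ (E n)) {r : Fin n → ℝ}
    (h : ∀ y, inner ℝ (covOp K y) y = ∑ i, r i ^ 2 * inner ℝ y (w i) ^ 2) (i : Fin n) :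
    covOp K (w i) = r i ^ 2 • w i := by
  let D : E n →ₗ[ℝ] E n :=
    ∑ i, r i ^ 2 • (InnerProductSpace.rankOne ℝ (w i) (w i) : E n →ₗ[ℝ] E n)
  have hDy : ∀ y z, inner ℝ (D y) z = ∑ i, r i ^ 2 * (inner ℝ y (w i) * inner ℝ z (w i)) := by
    intro y z
    simp only [D, LinearMap.sum_apply, LinearMap.smul_apply, ContinuousLinearMap.coe_coe,
      InnerProductSpace.rankOne_apply, sum_inner, real_inner_smul_left]
    simp only [real_inner_comm y, real_inner_comm z]
  have hD : D.IsSymmetric := by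
    intro y z
    rw [real_inner_comm (D z) y, hDy, hDy]
    simp only [mul_comm]
  have : (covOp K : E n →ₗ[ℝ] E n) = D := by
    refine eq_of_inner_self_eq (isSymmetric_covOp hK) hD fun y => ?_
    rw [ContinuousLinearMap.coe_coe, h, hDy]
    simp only [sq]
  rw [← ContinuousLinearMap.coe_coe, this]
  simp only [D, LinearMap.sum_apply, LinearMap.smul_apply, ContinuousLinearMap.coe_coe,
    InnerProductSpace.rankOne_apply, w.inner_eq_ite]
  simp

theorem det_covOp_eq_prod {K : Set (E n)} (w : OrthonormalBasis (Fin n) ℝ (E n)) {r : Fin n → ℝ}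
    (h : ∀ i, covOp K (w i) = r i ^ 2 • w i) :
    LinearMap.det (covOp K : E n →ₗ[ℝ] E n) = (∏ i, r i) ^ 2 := by
  rw [← LinearMap.det_toMatrix w.toBasis]
  have : LinearMap.toMatrix w.toBasis w.toBasis (covOp K : E n →ₗ[ℝ] E n) =
      Matrix.diagonal fun i => r i ^ 2 := by
    ext i j
    rw [LinearMap.toMatrix_apply, OrthonormalBasis.coe_toBasis, ContinuousLinearMap.coe_coe, h,
      OrthonormalBasis.coe_toBasis_repr_apply, w.repr_apply_apply, real_inner_smul_right,
      w.inner_eq_ite, Matrix.diagonal_apply]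
    split_ifs with hij
    · rw [hij, mul_one]
    · simp
  rw [this, Matrix.det_diagonal, Finset.prod_pow]

theorem exists_principalAxes {K : Set (E n)} (hK : IsConvexBody K) (hc : IsCentered K) :
    ∃ w : OrthonormalBasis (Fin n) ℝ (E n), IsPrincipalAxes w (inertiaEllipsoid K) := by
  have hfr : Module.finrank ℝ (E n) = n := finrank_euclideanSpace_fin
  have hA := isSymmetric_covOp hK.isCompact
  set w := hA.eigenvectorBasis hfr
  set l := hA.eigenvalues hfr
  have hAw : ∀ i, covOp K (w i) = l i • w i := fun i => hA.apply_eigenvectorBasis hfr i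
  have hl : ∀ i, 0 < l i := fun i => by
    have := inner_covOp_self_pos hK (w.orthonormal.ne_zero i)
    rw [hAw, real_inner_smul_left, real_inner_self_eq_norm_sq, w.orthonormal.1 i] at this
    simpa using this
  refine ⟨w, fun i => Real.sqrt (l i), fun i => Real.sqrt_pos.2 (hl i),
    inertiaEllipsoid_eq hK hc w (fun i => Real.sqrt_pos.2 (hl i)) fun y => ?_⟩
  rw [inner_eq_sum w]
  refine Finset.sum_congr rfl fun i _ => ?_
  rw [inner_covOp_comm hK.isCompact, hAw, real_inner_smul_left, real_inner_comm,
    Real.sq_sqrt (hl i).le]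
  ring

theorem dualLWRatio_le_of_isPrincipalAxes (hn : 1 ≤ n) {K : Set (E n)} (hK : IsConvexBody K)
    (hc : IsCentered K) {w : OrthonormalBasis (Fin n) ℝ (E n)}
    (hw : IsPrincipalAxes w (inertiaEllipsoid K)) :
    dualLWRatio K w ≤ ENNReal.ofReal ((2 * Real.sqrt 3 * isotropicConstant K) ^ n) := by
  obtain ⟨r, hr, h⟩ := hw
  have hq := inner_covOp_self_eq_sum hK hc w hr h
  have hax := covOp_apply_axis hK.isCompact w hq
  obtain ⟨hL, hLn⟩ := isotropicConstant_spec hn hK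
  rw [det_covOp_eq_prod w hax] at hLn
  have hv := volume_real_pos hK
  set v := volume.real K with hv'
  set L := isotropicConstant K
  have hLn' : L ^ n * v = ∏ i, r i := (sq_eq_sq₀ (by positivity)
    (Finset.prod_nonneg fun i _ => (hr i).le)).1 hLn
  have hS : ∀ i, 0 < sectionProfile K (w i) 0 ∧
      v ≤ 2 * Real.sqrt 3 * (sectionProfile K (w i) 0 * r i) := by
    intro i
    obtain ⟨h0, h1, -⟩ := sectionProfile_bounds hK hc (w.orthonormal.1 i)
    refine ⟨h0, ?_⟩
    have h2 := inner_covOp_self_of_isCentered hK.isCompact hc (w i)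
    rw [hax, real_inner_smul_left, real_inner_self_eq_norm_sq, w.orthonormal.1 i, ← hv'] at h2
    have h3 : ∫ x in K, inner ℝ x (w i) ^ 2 = v * r i ^ 2 := by
      have : v * (r i ^ 2 * 1 ^ 2) = v * (v⁻¹ * ∫ x in K, inner ℝ x (w i) ^ 2) := by rw [h2]
      rw [← mul_assoc v v⁻¹, mul_inv_cancel₀ hv.ne'] at this
      linarith
    rw [h3, ← hv'] at h1
    have hri := hr i
    refine le_of_sq_le_sq ?_ (by positivity)
    rw [mul_pow, mul_pow, Real.sq_sqrt (by norm_num), mul_pow]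
    have : v * v ^ 2 ≤ v * (2 ^ 2 * 3 * (sectionProfile K (w i) 0 ^ 2 * r i ^ 2)) := by
      linarith
    exact le_of_mul_le_mul_left this hv
  -- The factor `v` in `∏ rᵢ = L ^ n * v` is what lowers the exponent of the volume from `n` to `n -
  -- 1`.
  have hprod : v ^ n ≤ (2 * Real.sqrt 3) ^ n * ((∏ i, sectionProfile K (w i) 0) * (L ^ n * v)) := by
    calc v ^ n = ∏ _i : Fin n, v := by simp
      _ ≤ ∏ i, 2 * Real.sqrt 3 * (sectionProfile K (w i) 0 * r i) :=
        Finset.prod_le_prod (fun _ _ => hv.le) fun i _ => (hS i).2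
      _ = _ := by
        rw [Finset.prod_mul_distrib, Finset.prod_const, Finset.prod_mul_distrib, hLn']; simp
  rw [dualLWRatio]
  simp only [sectionVolume_eq hK.isCompact]
  rw [← ENNReal.ofReal_prod_of_nonneg fun i _ => (hS i).1.le,
    ← ENNReal.ofReal_toReal hK.isCompact.measure_lt_top.ne, ← measureReal_def, ← hv',
    ← ENNReal.ofReal_pow hv.le,
    ← ENNReal.ofReal_div_of_pos (Finset.prod_pos fun i _ => (hS i).1)]
  refine ENNReal.ofReal_le_ofReal ?_
  rw [div_le_iff₀ (Finset.prod_pos fun i _ => (hS i).1)]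
  have hvn : v ^ n = v ^ (n - 1) * v := by
    rw [← pow_succ, Nat.sub_add_cancel hn]
  rw [hvn] at hprod
  refine le_of_mul_le_mul_right (hprod.trans_eq ?_) hv
  rw [mul_pow _ L]; ring

theorem le_dualLWRatio_of_isIsotropicWith {K : Set (E n)} {L : ℝ}
    (h : IsIsotropicWith K L) (w : OrthonormalBasis (Fin n) ℝ (E n)) :
    ENNReal.ofReal ((Real.sqrt 2 * L) ^ n) ≤ dualLWRatio K w := by
  have hK := h.isConvexBody
  have hv : volume.real K = 1 := by rw [measureReal_def, h.volume_eq_one]; rfl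
  have hL := h.nonneg
  have hS : ∀ i, 0 < sectionProfile K (w i) 0 ∧
      Real.sqrt 2 * L * sectionProfile K (w i) 0 ≤ 1 := by
    intro i
    obtain ⟨h0, -, h1⟩ := sectionProfile_bounds hK h.isCentered (w.orthonormal.1 i)
    rw [h.second_moment _ (w.orthonormal.1 i), hv] at h1
    refine ⟨h0, le_of_sq_le_sq ?_ zero_le_one⟩
    rw [mul_pow, mul_pow, Real.sq_sqrt (by norm_num)]
    linarith
  rw [dualLWRatio, h.volume_eq_one, one_pow]
  simp only [sectionVolume_eq hK.isCompact]
  have hp : 0 < ∏ i, sectionProfile K (w i) 0 := Finset.prod_pos fun i _ => (hS i).1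
  rw [← ENNReal.ofReal_prod_of_nonneg fun i _ => (hS i).1.le, ← ENNReal.ofReal_one,
    ← ENNReal.ofReal_div_of_pos hp]
  refine ENNReal.ofReal_le_ofReal ?_
  rw [le_div_iff₀ hp]
  calc (Real.sqrt 2 * L) ^ n * ∏ i, sectionProfile K (w i) 0
      = ∏ i, Real.sqrt 2 * L * sectionProfile K (w i) 0 := by
        rw [Finset.prod_mul_distrib]; simp
    _ ≤ ∏ _i : Fin n, 1 := Finset.prod_le_prod
        (fun i _ => mul_nonneg (by positivity) (hS i).1.le) fun i _ => (hS i).2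
    _ = 1 := by simp

end PrincipalAxes

/-! ### Compactness: the maximal isotropic constant is attained -/

section Compactness

open TopologicalSpace Metric

theorem infDist_combo_le {V : Type*} [NormedAddCommGroup V] [NormedSpace ℝ V] {C : Set V}
    (hC : IsCompact C) (hne : C.Nonempty) (hcv : Convex ℝ C) (x y : V) {a b : ℝ} (ha : 0 ≤ a)
    (hb : 0 ≤ b) (hab : a + b = 1) :
    infDist (a • x + b • y) C ≤ a * infDist x C + b * infDist y C := by
  obtain ⟨p, hp, hxp⟩ := hC.exists_infDist_eq_dist hne x
  obtain ⟨q, hq, hyq⟩ := hC.exists_infDist_eq_dist hne y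
  refine (infDist_le_dist_of_mem (hcv hp hq ha hb hab)).trans ?_
  rw [hxp, hyq]
  refine (dist_add_add_le _ _ _ _).trans ?_
  rw [dist_smul₀, dist_smul₀, Real.norm_of_nonneg ha, Real.norm_of_nonneg hb]

/-- For a nonempty compact set, convexity is equivalent to convexity of its distance function, and
that function depends continuously on the set in the Hausdorff metric. -/
theorem isClosed_setOf_convex {V : Type*} [NormedAddCommGroup V] [NormedSpace ℝ V] :
    IsClosed {C : NonemptyCompacts V | Convex ℝ (C : Set V)} := by
  have : {C : NonemptyCompacts V | Convex ℝ (C : Set V)} =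
      ⋂ (x : V) (y : V) (a : ℝ) (b : ℝ) (_ : 0 ≤ a) (_ : 0 ≤ b) (_ : a + b = 1),
        {C : NonemptyCompacts V |
          infDist (a • x + b • y) C ≤ a * infDist x C + b * infDist y C} := by
    ext C
    simp only [mem_iInter, mem_ofPred_eq]
    constructor
    · intro h x y a b ha hb hab
      exact infDist_combo_le C.isCompact C.nonempty h x y ha hb hab
    · intro h x hx y hy a b ha hb hab
      have h1 := h x y a b ha hb hab
      rw [infDist_zero_of_mem hx, infDist_zero_of_mem hy, mul_zero, mul_zero, add_zero] at h1
      exact (C.isCompact.isClosed.mem_iff_infDist_zero C.nonempty).2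
        (le_antisymm h1 infDist_nonneg)
  rw [this]
  have hcont : ∀ x : V, Continuous fun C : NonemptyCompacts V => infDist x (C : Set V) :=
    fun x => (lipschitz_infDist_set x).continuous
  refine isClosed_iInter fun x => isClosed_iInter fun y => isClosed_iInter fun a =>
    isClosed_iInter fun b => isClosed_iInter fun _ => isClosed_iInter fun _ =>
    isClosed_iInter fun _ => isClosed_le (hcont _) ?_
  exact (continuous_const.mul (hcont x)).add (continuous_const.mul (hcont y))

theorem isClosed_setOf_mem {V : Type*} [NormedAddCommGroup V] (x : V) :
    IsClosed {C : NonemptyCompacts V | x ∈ (C : Set V)} := by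
  have := NonemptyCompacts.isClosed_inter_nonempty_of_isClosed (isClosed_singleton (x := x))
  simpa only [inter_singleton_nonempty] using this

/-- If `x` were outside `D`, moving from `x` by `s` straight away from its nearest point in `D`
would stay in `C` and, by convexity of the distance to `D`, reach a point at distance at least `s`
from `D`. -/
theorem mem_of_dist_lt {V : Type*} [NormedAddCommGroup V] [NormedSpace ℝ V]
    {C D : NonemptyCompacts V} (hD : Convex ℝ (D : Set V)) {x : V} {s : ℝ} (hs : 0 < s)
    (hx : closedBall x s ⊆ C) (hd : dist C D < s) : x ∈ (D : Set V) := by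
  by_contra hxD
  have hd0 : 0 < infDist x D :=
    (D.isCompact.isClosed.notMem_iff_infDist_pos D.nonempty).1 hxD
  obtain ⟨p, hp, hxp⟩ := D.isCompact.exists_infDist_eq_dist D.nonempty x
  set d := infDist x (D : Set V)
  set y := x + (s / d) • (x - p) with hy
  have hyC : y ∈ (C : Set V) := by
    refine hx ?_
    rw [mem_closedBall, dist_eq_norm, hy, add_sub_cancel_left, norm_smul, ← dist_eq_norm, ← hxp,
      Real.norm_of_nonneg (by positivity), div_mul_cancel₀ _ hd0.ne']
  have h1 : infDist y D ≤ dist C D := by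
    rw [NonemptyCompacts.dist_eq]
    refine infDist_le_hausdorffDist_of_mem hyC ?_
    exact hausdorffEDist_ne_top_of_nonempty_of_bounded C.nonempty D.nonempty C.isCompact.isBounded
      D.isCompact.isBounded
  have h2 := infDist_combo_le D.isCompact D.nonempty hD p y (a := s / (s + d)) (b := d / (s + d))
    (by positivity) (by positivity) (by field_simp)
  have h3 : (s / (s + d)) • p + (d / (s + d)) • y = x := by
    rw [hy, smul_add, smul_smul, smul_sub,
      show d / (s + d) * (s / d) = s / (s + d) by field_simp]
    have : x = (s / (s + d) + d / (s + d)) • x := by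
      rw [show s / (s + d) + d / (s + d) = 1 by field_simp, one_smul]
    nth_rewrite 3 [this]
    module
  rw [h3, infDist_zero_of_mem hp, mul_zero, zero_add] at h2
  change d ≤ _ at h2
  rw [div_mul_eq_mul_div, le_div_iff₀ (by positivity)] at h2
  have := le_of_mul_le_mul_left h2 hd0
  linarith

variable {n : ℕ}

theorem isConvexBody_of_simplex_subset {C : Set (E n)} (hC : IsCompact C) (hcv : Convex ℝ C)
    (h0 : (0 : E n) ∈ C) (he : ∀ i, EuclideanSpace.single i (1 : ℝ) ∈ C) : IsConvexBody C := by
  refine ⟨hC, hcv, hcv.interior_nonempty_iff_affineSpan_eq_top.2 ?_⟩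
  rw [AffineSubspace.affineSpan_eq_top_iff_vectorSpan_eq_top_of_nonempty _ _ _ ⟨0, h0⟩, eq_top_iff,
    ← (EuclideanSpace.basisFun (Fin n) ℝ).toBasis.span_eq, Submodule.span_le]
  rintro _ ⟨i, rfl⟩
  have := vsub_mem_vectorSpan ℝ (he i) h0
  simpa using this

/-- The unit cube `[-1, 1]ⁿ`. -/
def cube (n : ℕ) : Set (E n) :=
  {x | ∀ i, |x i| ≤ 1}

theorem isCompact_cube : IsCompact (cube n) := by
  have : cube n = WithLp.ofLp ⁻¹' (Set.pi univ fun _ : Fin n => Icc (-1 : ℝ) 1) := by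
    ext x
    simp only [cube, abs_le, mem_preimage, Set.mem_pi, mem_univ, true_imp_iff, mem_Icc,
      mem_ofPred_eq]
  rw [this]
  exact (PiLp.homeomorph 2 (fun _ : Fin n => ℝ)).isCompact_preimage.2
    (isCompact_univ_pi fun _ => isCompact_Icc)

/-- Convex bodies between the standard simplex and the cube. -/
def normalizedBodies (n : ℕ) : Set (NonemptyCompacts (E n)) :=
  {C | (C : Set (E n)) ⊆ cube n} ∩ ({C | Convex ℝ (C : Set (E n))} ∩
    ({C | (0 : E n) ∈ (C : Set (E n))} ∩
      ⋂ i, {C | EuclideanSpace.single i (1 : ℝ) ∈ (C : Set (E n))}))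

/-- Blaschke selection: the nonempty compact subsets of the cube form a compact space, and the
remaining conditions are closed. The simplex keeps limits from degenerating. -/
theorem isCompact_normalizedBodies : IsCompact (normalizedBodies n) :=
  (NonemptyCompacts.isCompact_subsets_of_isCompact isCompact_cube).inter_right
    (isClosed_setOf_convex.inter ((isClosed_setOf_mem _).inter
      (isClosed_iInter fun _ => isClosed_setOf_mem _)))

theorem isConvexBody_of_mem_normalizedBodies {C : NonemptyCompacts (E n)}
    (hC : C ∈ normalizedBodies n) : IsConvexBody (C : Set (E n)) :=
  isConvexBody_of_simplex_subset C.isCompact hC.2.1 hC.2.2.1 fun i => mem_iInter.1 hC.2.2.2 i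

/-- Dominated convergence on the cube: indicators are eventually constant at each interior or
exterior point of the limit body, and the frontier of a convex set is null. -/
theorem continuousOn_setIntegral {F : Type*} [NormedAddCommGroup F] [NormedSpace ℝ F]
    {φ : E n → F} (hφ : Continuous φ) :
    ContinuousOn (fun C : NonemptyCompacts (E n) => ∫ x in (C : Set (E n)), φ x)
      (normalizedBodies n) := by
  intro C hC
  have hi : ∀ D : NonemptyCompacts (E n), ∫ x in (D : Set (E n)), φ x =
      ∫ x, (D : Set (E n)).indicator φ x := fun D =>
    (integral_indicator D.isCompact.measurableSet).symm
  simp only [ContinuousWithinAt, hi]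
  refine tendsto_integral_filter_of_dominated_convergence ((cube n).indicator fun x => ‖φ x‖)
    (Eventually.of_forall fun D =>
      hφ.aestronglyMeasurable.indicator D.isCompact.measurableSet) ?_ ?_ ?_
  · filter_upwards [self_mem_nhdsWithin] with D hD
    refine ae_of_all _ fun x => ?_
    by_cases hx : x ∈ (D : Set (E n))
    · rw [indicator_of_mem hx, indicator_of_mem (hD.1 hx)]
    · rw [indicator_of_notMem hx, norm_zero]
      exact indicator_nonneg (fun _ _ => norm_nonneg _) _
  · exact (hφ.norm.continuousOn.integrableOn_compact isCompact_cube).integrable_indicator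
      isCompact_cube.measurableSet
  · have hfr : ∀ᵐ x : E n, x ∉ frontier (C : Set (E n)) :=
      measure_eq_zero_iff_ae_notMem.1 (hC.2.1.addHaar_frontier volume)
    filter_upwards [hfr] with x hx
    refine tendsto_nhds_of_eventually_eq ?_
    by_cases hxC : x ∈ (C : Set (E n))
    · have hxi : x ∈ interior (C : Set (E n)) := by
        by_contra h
        exact hx (by rw [C.isCompact.isClosed.frontier_eq]; exact ⟨hxC, h⟩)
      obtain ⟨s, hs, hsC⟩ := nhds_basis_closedBall.mem_iff.1 (mem_interior_iff_mem_nhds.1 hxi)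
      filter_upwards [self_mem_nhdsWithin, mem_nhdsWithin_of_mem_nhds (ball_mem_nhds C hs)]
        with D hD hDC
      rw [indicator_of_mem hxC, indicator_of_mem (mem_of_dist_lt hD.2.1 hs hsC (mem_ball'.1 hDC))]
    · have hopen : IsOpen {D : NonemptyCompacts (E n) | x ∈ (D : Set (E n))}ᶜ :=
        (isClosed_setOf_mem x).isOpen_compl
      filter_upwards [mem_nhdsWithin_of_mem_nhds (hopen.mem_nhds hxC)] with D hD
      rw [indicator_of_notMem hxC, indicator_of_notMem (s := (D : Set (E n))) hD]

theorem continuousOn_det_covOp_div :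
    ContinuousOn (fun C : NonemptyCompacts (E n) =>
      (covOp (C : Set (E n))).det / volume.real (C : Set (E n)) ^ 2) (normalizedBodies n) := by
  have hv : ContinuousOn (fun C : NonemptyCompacts (E n) => volume.real (C : Set (E n)))
      (normalizedBodies n) := by
    have := continuousOn_setIntegral (n := n) (φ := fun _ => (1 : ℝ)) continuous_const
    simpa using this
  have hv0 : ∀ C ∈ normalizedBodies n, volume.real (C : Set (E n)) ≠ 0 := fun C hC =>
    (volume_real_pos (isConvexBody_of_mem_normalizedBodies hC)).ne'
  have hvi := hv.inv₀ hv0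
  have hb : ContinuousOn (fun C : NonemptyCompacts (E n) => barycentre (C : Set (E n)))
      (normalizedBodies n) := hvi.smul (continuousOn_setIntegral continuous_id)
  have hcov : ContinuousOn (fun C : NonemptyCompacts (E n) => covOp (C : Set (E n)))
      (normalizedBodies n) :=
    (hvi.smul (continuousOn_setIntegral continuous_rankOne_self)).sub
      (continuous_rankOne_self.comp_continuousOn hb)
  exact (ContinuousLinearMap.continuous_det.comp_continuousOn hcov).div (hv.pow 2)
    fun C hC => pow_ne_zero 2 (hv0 C hC)

/-- Among simplices with vertices in `K`, one of maximal volume is sent to the standard simplex.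
Replacing its `i`-th vertex by `x ∈ K` multiplies the determinant by the `i`-th new coordinate of
`x`, so maximality bounds that coordinate by one in absolute value. -/
theorem exists_normalized_image (hn : 1 ≤ n) {K : Set (E n)} (hK : IsConvexBody K) :
    ∃ (a : E n) (T : E n ≃ₗ[ℝ] E n), ∃ C ∈ normalizedBodies n,
      (C : Set (E n)) = (fun x => a + T x) '' K := by
  have : Nonempty (Fin n) := ⟨⟨0, hn⟩⟩
  let M : E n × (Fin n → E n) → Matrix (Fin n) (Fin n) ℝ := fun p =>
    Matrix.of fun i j => (p.2 i - p.1) j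
  have hM : Continuous fun p => |(M p).det| := by
    refine (Continuous.matrix_det ?_).abs
    refine continuous_matrix fun i j => ?_
    simp only [M, Matrix.of_apply]
    fun_prop
  have hcomp : IsCompact (K ×ˢ Set.pi univ fun _ : Fin n => K) :=
    hK.isCompact.prod (isCompact_univ_pi fun _ => hK.isCompact)
  obtain ⟨c, hc⟩ := hK.interior_nonempty
  have hcK := interior_subset hc
  obtain ⟨p, hpK, hmax⟩ := hcomp.exists_isMaxOn ⟨(c, fun _ => c), hcK, fun _ _ => hcK⟩
    hM.continuousOn
  -- A small simplex inside a ball in `K` already has nonzero determinant.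
  have hdet : (M p).det ≠ 0 := by
    obtain ⟨ε, hε, hball⟩ := nhds_basis_closedBall.mem_iff.1 (mem_interior_iff_mem_nhds.1 hc)
    have hq : (c, fun i => c + ε • EuclideanSpace.single i (1 : ℝ)) ∈
        K ×ˢ Set.pi univ fun _ : Fin n => K := by
      refine ⟨hcK, fun i _ => hball ?_⟩
      simp [norm_smul, abs_of_pos hε]
    have h1 := hmax hq
    have h2 : M (c, fun i => c + ε • EuclideanSpace.single i (1 : ℝ)) =
        ε • (1 : Matrix (Fin n) (Fin n) ℝ) := by
      ext i j
      simp [M, Matrix.one_apply, eq_comm]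
    simp only [mem_ofPred_eq] at h1
    rw [h2, Matrix.det_smul, Matrix.det_one, mul_one] at h1
    have h3 : 0 < |ε ^ Fintype.card (Fin n)| := by positivity
    exact abs_pos.1 (h3.trans_le h1)
  have hli : LinearIndependent ℝ fun i => p.2 i - p.1 := by
    have h1 := Matrix.linearIndependent_rows_of_det_ne_zero hdet
    refine LinearIndependent.of_comp (WithLp.linearEquiv 2 ℝ (Fin n → ℝ)).toLinearMap ?_
    exact h1
  let b := basisOfLinearIndependentOfCardEqFinrank hli (by simp)
  have hb : ∀ i, b i = p.2 i - p.1 := fun i => by simp [b]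
  let e := (EuclideanSpace.basisFun (Fin n) ℝ).toBasis
  let T : E n ≃ₗ[ℝ] E n := b.equiv e (Equiv.refl _)
  have hTb : ∀ i, T (b i) = EuclideanSpace.single i (1 : ℝ) := fun i => by
    have := b.equiv_apply i e (Equiv.refl _)
    rw [this]
    simp [e]
  have hcoord : ∀ x ∈ K, ∀ i, |b.repr (x - p.1) i| ≤ 1 := by
    intro x hx i
    set q : E n × (Fin n → E n) := (p.1, Function.update p.2 i x) with hq
    have hqK : q ∈ K ×ˢ Set.pi univ fun _ : Fin n => K := by
      refine ⟨hpK.1, fun j _ => ?_⟩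
      rw [hq]
      rcases eq_or_ne j i with rfl | hji
      · simpa using hx
      · simpa [Function.update_of_ne hji] using hpK.2 j (mem_univ j)
    have h1 := hmax hqK
    have h2 : M q = (M p).updateRow i (∑ k, b.repr (x - p.1) k • M p k) := by
      have hsum := b.sum_repr (x - p.1)
      ext k j
      rcases eq_or_ne k i with rfl | hki
      · rw [Matrix.updateRow_self]
        have h3 := congrArg (fun v : E n => v j) hsum
        simp only [hb] at h3
        simp only [M, hq, Matrix.of_apply, Function.update_self]
        rw [← h3]
        simp [Finset.sum_apply]
      · rw [Matrix.updateRow_ne hki]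
        simp [M, hq, Function.update_of_ne hki]
    simp only [mem_ofPred_eq] at h1
    rw [h2, Matrix.det_updateRow_sum, smul_eq_mul, abs_mul] at h1
    exact le_of_mul_le_mul_right (h1.trans_eq (one_mul _).symm) (abs_pos.2 hdet)
  have himg : ∀ x, -T p.1 + T x = T (x - p.1) := fun x => by rw [map_sub]; abel
  have hTx : ∀ x i, T x i = b.repr x i := fun x i => by
    nth_rewrite 1 [← b.sum_repr x]
    simp only [map_sum, map_smul, hTb]
    simp [Finset.sum_apply, Pi.single_apply]
  have hbody := hK.affine_image (-T p.1) T
  refine ⟨-T p.1, T, ⟨⟨_, hbody.isCompact⟩, ⟨_, p.1, hpK.1, rfl⟩⟩, ⟨?_, hbody.convex, ?_, ?_⟩, rfl⟩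
  · rintro _ ⟨x, hx, rfl⟩ i
    simp only [himg, hTx]
    exact hcoord x hx i
  · exact ⟨p.1, hpK.1, by simp⟩
  · refine mem_iInter.2 fun i => ⟨p.2 i, hpK.2 i (mem_univ i), ?_⟩
    simp only [himg, ← hb, hTb]

theorem isotropicConstant_affine_image (hn : 1 ≤ n) {K : Set (E n)} (hK : IsConvexBody K)
    (a : E n) (T : E n ≃ₗ[ℝ] E n) :
    isotropicConstant ((fun x => a + T x) '' K) = isotropicConstant K := by
  obtain ⟨h1, h2⟩ := isotropicConstant_spec hn hK
  obtain ⟨h3, h4⟩ := isotropicConstant_spec hn (hK.affine_image a T)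
  have hv := volume_real_pos hK
  have hd : 0 < |LinearMap.det (T : E n →ₗ[ℝ] E n)| := abs_pos.2 (det_ne_zero T)
  rw [det_covOp_affine_image hK, volume_real_affine_image, ← h2, ← mul_pow,
    ← sq_abs (LinearMap.det (T : E n →ₗ[ℝ] E n) * _), abs_mul, abs_of_nonneg
      (mul_nonneg (pow_nonneg h1 n) hv.le), sq_eq_sq₀ (by positivity) (by positivity)] at h4
  have h5 : (|LinearMap.det (T : E n →ₗ[ℝ] E n)| * volume.real K) *
      isotropicConstant ((fun x => a + T x) '' K) ^ n =
      (|LinearMap.det (T : E n →ₗ[ℝ] E n)| * volume.real K) * isotropicConstant K ^ n := by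
    linarith
  exact (pow_left_inj₀ h3 h1 (by omega)).1 (mul_left_cancel₀ (by positivity) h5)

theorem exists_isMax_isotropicConstant (hn : 1 ≤ n) : ∃ K : Set (E n), IsConvexBody K ∧
    ∀ K' : Set (E n), IsConvexBody K' → isotropicConstant K' ≤ isotropicConstant K := by
  have hball : IsConvexBody (closedBall (0 : E n) 1) :=
    ⟨isCompact_closedBall _ _, convex_closedBall _ _,
      (nonempty_ball.2 one_pos).mono ball_subset_interior_closedBall⟩
  obtain ⟨-, -, C₀, hC₀, -⟩ := exists_normalized_image hn hball
  obtain ⟨C, hC, hmax⟩ := isCompact_normalizedBodies.exists_isMaxOn ⟨C₀, hC₀⟩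
    (continuousOn_det_covOp_div (n := n))
  have hval : ∀ D ∈ normalizedBodies n,
      (covOp (D : Set (E n))).det / volume.real (D : Set (E n)) ^ 2 =
        (isotropicConstant (D : Set (E n)) ^ n) ^ 2 := by
    intro D hD
    have hb := isConvexBody_of_mem_normalizedBodies hD
    have hv := volume_real_pos hb
    rw [div_eq_iff (by positivity), ← mul_pow]
    exact (isotropicConstant_spec hn hb).2.symm
  refine ⟨C, isConvexBody_of_mem_normalizedBodies hC, fun K hK => ?_⟩
  obtain ⟨a, T, D, hD, hDK⟩ := exists_normalized_image hn hK
  rw [← isotropicConstant_affine_image hn hK a T, ← hDK]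
  have h1 := hmax hD
  simp only [mem_ofPred_eq] at h1
  rw [hval D hD, hval C hC, ← pow_mul, ← pow_mul] at h1
  exact le_of_pow_le_pow_left₀ (by omega)
    (isotropicConstant_spec hn (isConvexBody_of_mem_normalizedBodies hC)).1 h1

end Compactness

/-! ### The minimum over orthonormal bases is attained -/

section Minimum

variable {n : ℕ}

/-- The cylinder of height one in direction `w` over the central section `K ∩ w^⊥`. -/
def sectionCylinder (K : Set (E n)) (w : E n) : Set (E n) :=
  {x | inner ℝ x w ∈ Icc (0 : ℝ) 1 ∧ x - (inner ℝ x w : ℝ) • w ∈ K}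

theorem isClosed_sectionCylinder {K : Set (E n)} (hK : IsClosed K) :
    IsClosed {p : E n × E n | p.2 ∈ sectionCylinder K p.1} := by
  have h1 : Continuous fun p : E n × E n => (inner ℝ p.2 p.1 : ℝ) := by fun_prop
  exact (isClosed_Icc.preimage h1).inter
    (hK.preimage (f := fun p : E n × E n => p.2 - (inner ℝ p.2 p.1 : ℝ) • p.1) (by fun_prop))

/-- Sections in different directions are measured on different subspaces; unit-height cylinders put
them all in `ℝⁿ`, as fibres of a single closed set. -/
theorem volume_sectionCylinder {K : Set (E n)} (hK : IsCompact K) {w : E n} (hw : ‖w‖ = 1) :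
    volume (sectionCylinder K w) = sectionVolume K w := by
  have hcl : MeasurableSet (sectionCylinder K w) :=
    ((isClosed_sectionCylinder hK.isClosed).preimage
      (f := fun x : E n => (w, x)) (by fun_prop)).measurableSet
  rw [← (measurePreserving_lineSplit w hw).measure_preimage hcl.nullMeasurableSet]
  have : (fun p : ℝ × (Submodule.span ℝ {w})ᗮ => p.1 • w + (p.2 : E n)) ⁻¹' sectionCylinder K w =
      Icc (0 : ℝ) 1 ×ˢ {y : (Submodule.span ℝ {w})ᗮ | (y : E n) ∈ K} := by
    ext ⟨t, y⟩
    have h0 : inner ℝ (y : E n) w = 0 :=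
      Submodule.mem_orthogonal_singleton_iff_inner_left.1 y.2
    have h3 : inner ℝ (t • w + (y : E n)) w = t := by
      rw [inner_add_left, h0, inner_smul_left, real_inner_self_eq_norm_sq, hw]; simp
    simp only [sectionCylinder, mem_preimage, mem_ofPred_eq, h3, mem_prod, add_sub_cancel_left]
  rw [this, Measure.volume_eq_prod, Measure.prod_prod, Real.volume_Icc]
  simp [sectionVolume]

theorem norm_le_of_mem_sectionCylinder {K : Set (E n)} {R : ℝ} (hR : ∀ x ∈ K, ‖x‖ ≤ R) {w : E n}
    (hw : ‖w‖ = 1) {x : E n} (hx : x ∈ sectionCylinder K w) : ‖x‖ ≤ R + 1 := by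
  calc ‖x‖ = ‖(x - (inner ℝ x w : ℝ) • w) + (inner ℝ x w : ℝ) • w‖ := by rw [sub_add_cancel]
    _ ≤ ‖x - (inner ℝ x w : ℝ) • w‖ + ‖(inner ℝ x w : ℝ) • w‖ := norm_add_le _ _
    _ ≤ R + 1 := by
      gcongr
      · exact hR _ hx.2
      · rw [norm_smul, hw, mul_one, Real.norm_of_nonneg hx.1.1]; exact hx.1.2

/-- The measure of the sections of a closed set inside a compact set is upper semicontinuous. -/
theorem upperSemicontinuousOn_measure_section {X Y : Type*} [TopologicalSpace X]
    [TopologicalSpace Y] [MeasurableSpace Y] (μ : Measure Y) [μ.OuterRegular] {s : Set X}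
    {G : Set (X × Y)} (hG : IsClosed G) {B : Set Y} (hB : IsCompact B)
    (hGB : ∀ x ∈ s, ∀ y, (x, y) ∈ G → y ∈ B) :
    UpperSemicontinuousOn (fun x => μ {y | (x, y) ∈ G}) s := by
  intro x _ c hc
  obtain ⟨U, hU, hUo, hUc⟩ := Set.exists_isOpen_lt_of_lt _ c hc
  -- The compact set `B \ U` misses the fibre over `x`, hence also all fibres over nearby points;
  -- these are then contained in `U`.
  have hev : ∀ᶠ x' in 𝓝 x, ∀ y ∈ B \ U, (x', y) ∉ G := by
    refine (hB.diff hUo).eventually_forall_of_forall_eventually fun y hy => ?_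
    exact hG.isOpen_compl.mem_nhds fun h => hy.2 (hU h)
  filter_upwards [mem_nhdsWithin_of_mem_nhds hev, self_mem_nhdsWithin] with x' hx' hxs
  refine (measure_mono fun y hy => ?_).trans_lt hUc
  by_contra hyU
  exact hx' y ⟨hGB x' hxs y hy, hyU⟩ hy

theorem isCompact_setOf_orthonormal : IsCompact {v : Fin n → E n | Orthonormal ℝ v} := by
  refine (isCompact_univ_pi fun _ => isCompact_closedBall (0 : E n) 1).of_isClosed_subset ?_ ?_
  · have : {v : Fin n → E n | Orthonormal ℝ v} =
        ⋂ (i : Fin n) (j : Fin n), {v | inner ℝ (v i) (v j) = if i = j then (1 : ℝ) else 0} := by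
      ext v
      simp only [mem_iInter, mem_ofPred_eq, orthonormal_iff_ite]
    rw [this]
    exact isClosed_iInter fun i => isClosed_iInter fun j =>
      isClosed_eq (by fun_prop) continuous_const
  · intro v hv i _
    rw [mem_closedBall_zero_iff, hv.1 i]

/-- The product of section volumes is the measure of a product of cylinders in `(ℝⁿ)ⁿ`, that is, of
one fibre of a closed set over the space of frames. Upper semicontinuity and compactness then give a
maximizer. -/
theorem exists_isMax_prod_sectionVolume {K : Set (E n)} (hK : IsCompact K) :
    ∃ w : OrthonormalBasis (Fin n) ℝ (E n), ∀ v : OrthonormalBasis (Fin n) ℝ (E n),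
      ∏ i, sectionVolume K (v i) ≤ ∏ i, sectionVolume K (w i) := by
  obtain ⟨R, hR⟩ := hK.isBounded.exists_norm_le
  set G : Set ((Fin n → E n) × (Fin n → E n)) :=
    ⋂ i, {p | p.2 i ∈ sectionCylinder K (p.1 i)} with hG'
  have hG : IsClosed G := isClosed_iInter fun i =>
    (isClosed_sectionCylinder hK.isClosed).preimage
      (f := fun p : (Fin n → E n) × (Fin n → E n) => (p.1 i, p.2 i)) (by fun_prop)
  have hreg : (volume : Measure (Fin n → E n)).OuterRegular := by
    have : IsLocallyFiniteMeasure (volume : Measure (Fin n → E n)) := by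
      rw [volume_pi]; infer_instance
    infer_instance
  have husc := upperSemicontinuousOn_measure_section (volume : Measure (Fin n → E n))
    (s := {v | Orthonormal ℝ v}) hG
    (isCompact_univ_pi fun _ => isCompact_closedBall (0 : E n) (R + 1)) (by
      intro v hv x hx i _
      rw [mem_closedBall_zero_iff]
      exact norm_le_of_mem_sectionCylinder hR (hv.1 i) (mem_iInter.1 hx i))
  have hvol : ∀ v : Fin n → E n, Orthonormal ℝ v →
      volume {x | (v, x) ∈ G} = ∏ i, sectionVolume K (v i) := by
    intro v hv
    have : {x | (v, x) ∈ G} = Set.pi univ fun i => sectionCylinder K (v i) := by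
      ext x
      simp [hG', Set.mem_pi]
    rw [this, volume_pi_pi]
    exact Finset.prod_congr rfl fun i _ => volume_sectionCylinder hK (hv.1 i)
  obtain ⟨v, hv, hmax⟩ := husc.exists_isMaxOn
    ⟨⇑(EuclideanSpace.basisFun (Fin n) ℝ), (EuclideanSpace.basisFun (Fin n) ℝ).orthonormal⟩ isCompact_setOf_orthonormal
  have hspan : ⊤ ≤ Submodule.span ℝ (range v) := by
    rw [hv.linearIndependent.span_eq_top_of_card_eq_finrank' (by simp)]
  refine ⟨OrthonormalBasis.mk hv hspan, fun u => ?_⟩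
  rw [OrthonormalBasis.coe_mk, ← hvol v hv, ← hvol u u.orthonormal]
  exact hmax u.orthonormal

theorem isLeast_dualLambda {K : Set (E n)} (hK : IsCompact K) :
    IsLeast (range (dualLWRatio K)) (dualLambda K) := by
  obtain ⟨w, hw⟩ := exists_isMax_prod_sectionVolume hK
  refine ⟨⟨w, le_antisymm (le_iInf fun v => ?_) (iInf_le _ w)⟩, ?_⟩
  · exact ENNReal.div_le_div_left (hw v) _
  · rintro _ ⟨v, rfl⟩
    exact iInf_le _ v

/-! ### Attainment of `L_n` and the bounds for `Λ̃(K)` and `Λ̃(n)` -/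

theorem isGreatest_isotropicConstants (hn : 1 ≤ n) :
    IsGreatest (isotropicConstants n) (maxIsotropicConstant n) := by
  obtain ⟨K, hK, hmax⟩ := exists_isMax_isotropicConstant hn
  have h : IsGreatest (isotropicConstants n) (isotropicConstant K) :=
    ⟨⟨K, hK, rfl⟩, by rintro _ ⟨K', hK', rfl⟩; exact hmax K' hK'⟩
  rwa [maxIsotropicConstant, h.csSup_eq]

theorem dualLambda_le (hn : 1 ≤ n) {K : Set (E n)} (hK : IsConvexBody K) (hc : IsCentered K) :
    dualLambda K ≤ ENNReal.ofReal ((2 * Real.sqrt 3 * isotropicConstant K) ^ n) := by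
  obtain ⟨w, hw⟩ := exists_principalAxes hK hc
  exact (iInf_le _ w).trans (dualLWRatio_le_of_isPrincipalAxes hn hK hc hw)

theorem le_dualLambdaSup (hn : 1 ≤ n) :
    ENNReal.ofReal ((Real.sqrt 2 * maxIsotropicConstant n) ^ n) ≤ dualLambdaSup n := by
  obtain ⟨K, hK, hL⟩ := (isGreatest_isotropicConstants hn).1
  obtain ⟨a, T, h⟩ := exists_isIsotropicWith_isotropicConstant hn hK
  rw [← hL]
  exact (le_iInf fun w => le_dualLWRatio_of_isIsotropicWith h w).trans
    (le_iSup₂_of_le _ h.isConvexBody (le_iSup_of_le h.isCentered le_rfl))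

theorem dualLambdaSup_le (hn : 1 ≤ n) :
    dualLambdaSup n ≤ ENNReal.ofReal ((2 * Real.sqrt 3 * maxIsotropicConstant n) ^ n) := by
  refine iSup₂_le fun K hK => iSup_le fun hc => (dualLambda_le hn hK hc).trans ?_
  have h0 := (isotropicConstant_spec hn hK).1
  have h1 := (isGreatest_isotropicConstants hn).2 ⟨K, hK, rfl⟩
  exact ENNReal.ofReal_le_ofReal (by gcongr)

end Minimum

end ReverseLW

end

theorem theorem1p1 (n : ℕ) (hn : 1 ≤ n) :
    (∀ K : Set (ReverseLW.E n), ReverseLW.IsConvexBody K → ReverseLW.IsCentered K →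
      -- the infimum defining `Λ̃(K)` is a minimum
      IsLeast (Set.range (ReverseLW.dualLWRatio K)) (ReverseLW.dualLambda K) ∧
      ReverseLW.dualLambda K ≤
        ENNReal.ofReal ((2 * Real.sqrt 3 * ReverseLW.isotropicConstant K) ^ n) ∧
      -- principal axes of `Z₂(K)` exist, and any system of them witnesses the bound
      (∃ w : OrthonormalBasis (Fin n) ℝ (ReverseLW.E n),
        ReverseLW.IsPrincipalAxes w (ReverseLW.inertiaEllipsoid K)) ∧
      (∀ w : OrthonormalBasis (Fin n) ℝ (ReverseLW.E n),
        ReverseLW.IsPrincipalAxes w (ReverseLW.inertiaEllipsoid K) →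
        ReverseLW.dualLWRatio K w ≤
          ENNReal.ofReal ((2 * Real.sqrt 3 * ReverseLW.isotropicConstant K) ^ n))) ∧
    -- `L_n` is a maximum
    IsGreatest (ReverseLW.isotropicConstants n) (ReverseLW.maxIsotropicConstant n) ∧
    ENNReal.ofReal ((Real.sqrt 2 * ReverseLW.maxIsotropicConstant n) ^ n) ≤
      ReverseLW.dualLambdaSup n ∧
    ReverseLW.dualLambdaSup n ≤
      ENNReal.ofReal ((2 * Real.sqrt 3 * ReverseLW.maxIsotropicConstant n) ^ n) := by
  refine ⟨fun K hK hc => ⟨ReverseLW.isLeast_dualLambda hK.isCompact,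
    ReverseLW.dualLambda_le hn hK hc, ReverseLW.exists_principalAxes hK hc,
    fun w hw => ReverseLW.dualLWRatio_le_of_isPrincipalAxes hn hK hc hw⟩,
    ReverseLW.isGreatest_isotropicConstants hn, ReverseLW.le_dualLambdaSup hn,
    ReverseLW.dualLambdaSup_le hn⟩
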